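/- **Theorem 3.1.** For $n,d\ge 1$, $\eta\in(0,1)$ and $f\colon(\mathbb R^d)^n\to\mathbb R^d$, set $$S_\eta^f(X)=\sup\bigl\{\|f(X)-f(X')\| : X'\in(\mathbb R^d)^n,\ \#\{i: X_i\ne X'_i\}\le\lfloor\eta n\rfloor\bigr\}\in[0,\infty],$$ $$\mathsf{ES}_{\eta,2}(f;\mu)=\Bigl(\mathbb E_{X\sim\mathcal N(\mu,\mathbb I_d)^{\otimes n}}\bigl[S_\eta^f(X)^2\bigr]\Bigr)^{1/2}\in[0,\infty],$$ where $\|\cdot\|$ is the Euclidean norm. For every $C_{\mathsf{MSE}}>0$ there are a constant $c>0$ and an integer $N$, both depending only on $C_{\mathsf{MSE}}$, such that the following holds for all $n\ge N$ and all $d\ge1$. Let $f\colon(\mathbb R^d)^n\to\mathbb R^d$ be any measurable estimator with $$\sup_{\mu\in\mathbb R^d}\mathbb E_{X\sim\mathcal N(\mu,\mathbb I_d)^{\otimes n}}\bigl[\|f(X)-\mu\|^2\bigr]\le C_{\mathsf{MSE}}\,\frac dn .$$ Then for every $\eta\in(0,1)$ with $\eta n\ge1$ (at least one sample may be changed), $$\sup_{\mu\in\mathbb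 R^d}\mathsf{ES}_{\eta,2}(f;\mu)\ \ge\ c\left(\eta+\sqrt{\frac{\eta d}{n}}\right).$$ -/

import Mathlib

open MeasureTheory ProbabilityTheory
open scoped ENNReal

namespace EmpiricalSensitivity

noncomputable section

/-- The class of Gaussians `N(μ, I_d)` on `ℝ^d`, parameterized by the mean. -/
def gaussianClass (d : ℕ) (μ : EuclideanSpace ℝ (Fin d)) : Measure (EuclideanSpace ℝ (Fin d)) :=
  multivariateGaussian μ 1

/-- The law of `n` i.i.d. samples from `D`. -/
def iidLaw {𝒳 : Type*} [MeasurableSpace 𝒳] (D : Measure 𝒳) (n : ℕ) : Measure (Fin n → 𝒳) :=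
  Measure.pi (fun _ => D)

/-- `f` is `(C, γ)`-uniformly MSE-accurate for the class `D` (with parameter set `E`):
`sup_θ 𝔼_{X ∼ D_θ^{⊗ n}} ‖f(X) - θ‖² ≤ C γ`. The supremum and the expectations are taken in
`[0, ∞]`, so that finiteness of the mean-squared errors is part of the condition. -/
def UniformlyMSEAccurate {𝒳 E : Type*} [MeasurableSpace 𝒳] [NormedAddCommGroup E] {n : ℕ}
    (D : E → Measure 𝒳) (C γ : ℝ) (f : (Fin n → 𝒳) → E) : Prop :=
  ⨆ θ : E, ∫⁻ x, ‖f x - θ‖ₑ ^ 2 ∂(iidLaw (D θ) n) ≤ ENNReal.ofReal (C * γ)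

open Classical in
/-- The pointwise empirical sensitivity `S_η^f(x)`: the supremum of `‖f(x) - f(x')‖` over all
datasets `x'` at Hamming distance at most `⌊η n⌋` from `x`. It may be infinite. -/
def pointwiseSensitivity {𝒳 E : Type*} [NormedAddCommGroup E] {n : ℕ}
    (η : ℝ) (f : (Fin n → 𝒳) → E) (x : Fin n → 𝒳) : ℝ≥0∞ :=
  ⨆ (x' : Fin n → 𝒳) (_ : hammingDist x x' ≤ ⌊η * n⌋₊), ‖f x - f x'‖ₑ

/-- The `L^q`-distributional empirical sensitivity `(𝔼_{X ∼ D^{⊗ n}} S_η^f(X)^q)^{1/q}`. -/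
def distributionalSensitivity {𝒳 E : Type*} [MeasurableSpace 𝒳] [NormedAddCommGroup E] {n : ℕ}
    (η : ℝ) (q : ℕ) (f : (Fin n → 𝒳) → E) (D : Measure 𝒳) : ℝ≥0∞ :=
  (∫⁻ x, pointwiseSensitivity η f x ^ q ∂(iidLaw D n)) ^ (1 / (q : ℝ))

end

end EmpiricalSensitivity

namespace EmpiricalSensitivity

/-! ### Gaussian translations and their densities -/

/-! Write `F_μ(x) = f(x + μ) - μ` for the error at mean `μ` as a function of standard noise `x`, and
`L_δ` for the likelihood ratio of translating every sample by `δ e_j`. A change of variables shows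
that `F_μ,j` and `L_δ - 1` have correlation `δ` plus the increment of the bias from `μ` to `μ + δ
e_j` (`integral_shift`). Summed over `j`, these increments form a discrete divergence of a bounded
field, which cannot stay above a positive constant for all `μ` (`nonpos_of_le_sum_differences`). So
at some mean the correlations nearly add up to `d δ` or more. Low sensitivity is contradicted by
bounding them from above. By the accuracy of `f`, replacing `L_δ - 1` by an `H_j` within `ρ` in `L²`
costs only `d √(C/n) ρ` (`le_of_approx`).

Let `k = ⌊ηn⌋` and let `r` be the sensitivity. For `√(ηd/n)`, cut the samples into about `n/k`
blocks of at most `k` and let `H_j` be the sum of the centered likelihood ratios of shifting one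
block. Erasing a block changes `f` by at most `r` in mean square and kills the correlation with that
block's term; with `δ` of order `1/√n`, Cauchy–Schwarz gives `√(dk) ≤ 6nr` (`sqrt_dim_le`,
`sqrt_dim_mul_le`).

For `η` there are two regimes. If `k` is at least of order `√n`, couple the noise with its translate
by `δ = k/(8n)` so that, outside an event of probability `1/4`, at most `k` samples differ; there
the output moves by at most `r` in mean square, while on average it must follow the translation
(`translation_le_of_coupling`). If `k` is smaller, imitate the translation by shifting a random set
of at most `k` samples by a constant `τ`: the mixture of the resulting laws is close to the
translated law in chi-square distance, and each component moves the mean output by at most `r`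
(`translation_le_of_sparse`). -/

theorem lintegral_pi_prod {ι : Type*} [Fintype ι] {X : ι → Type*} [∀ i, MeasurableSpace (X i)]
    (P : ∀ i, Measure (X i)) [∀ i, IsProbabilityMeasure (P i)] {q : ∀ i, X i → ℝ≥0∞}
    (hq : ∀ i, Measurable (q i)) :
    ∫⁻ x, ∏ i, q i (x i) ∂(Measure.pi P) = ∏ i, ∫⁻ y, q i y ∂(P i) := by
  have hind : iIndepFun (fun i (x : ∀ i, X i) => q i (x i)) (Measure.pi P) :=
    iIndepFun_pi (X := fun i => q i) (fun i => (hq i).aemeasurable)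
  rw [lintegral_prod_eq_prod_lintegral_of_indepFun Finset.univ _ hind
    (fun i => (hq i).comp (measurable_pi_apply i))]
  refine Finset.prod_congr rfl fun i _ => ?_
  exact (measurePreserving_eval P i).lintegral_comp (hq i)

theorem pi_withDensity {ι : Type*} [Fintype ι] {X : ι → Type*} [∀ i, MeasurableSpace (X i)]
    (P : ∀ i, Measure (X i)) [∀ i, IsProbabilityMeasure (P i)] {q : ∀ i, X i → ℝ≥0∞}
    (hq : ∀ i, Measurable (q i)) [∀ i, SigmaFinite ((P i).withDensity (q i))] :
    Measure.pi (fun i => (P i).withDensity (q i)) =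
      (Measure.pi P).withDensity (fun x => ∏ i, q i (x i)) := by
  refine Measure.pi_eq fun s hs => ?_
  rw [withDensity_apply _ (MeasurableSet.univ_pi hs),
    ← lintegral_indicator (MeasurableSet.univ_pi hs)]
  have h : ∀ x : ∀ i, X i, (Set.univ.pi s).indicator (fun x => ∏ i, q i (x i)) x =
      ∏ i, (s i).indicator (q i) (x i) := by
    intro x
    by_cases hx : x ∈ Set.univ.pi s
    · rw [Set.indicator_of_mem hx]
      exact Finset.prod_congr rfl fun i _ => (Set.indicator_of_mem (hx i trivial) _).symm
    · rw [Set.indicator_of_notMem hx]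
      simp only [Set.mem_pi, Set.mem_univ, true_implies, not_forall] at hx
      obtain ⟨i, hi⟩ := hx
      exact (Finset.prod_eq_zero (Finset.mem_univ i) (Set.indicator_of_notMem hi _)).symm
  simp_rw [h]
  rw [lintegral_pi_prod P (q := fun i => (s i).indicator (q i)) fun i => (hq i).indicator (hs i)]
  refine Finset.prod_congr rfl fun i _ => ?_
  rw [withDensity_apply _ (hs i), lintegral_indicator (hs i)]

/-- Translations with densities tensorize. -/
theorem pi_map_eq_withDensity {ι : Type*} [Fintype ι] {X : ι → Type*}
    [∀ i, MeasurableSpace (X i)]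
    (P : ∀ i, Measure (X i)) [∀ i, IsProbabilityMeasure (P i)] {q : ∀ i, X i → ℝ≥0∞}
    (hq : ∀ i, Measurable (q i)) {T : ∀ i, X i → X i} (hT : ∀ i, Measurable (T i))
    (h : ∀ i, (P i).map (T i) = (P i).withDensity (q i)) :
    (Measure.pi P).map (fun x i => T i (x i)) =
      (Measure.pi P).withDensity (fun x => ∏ i, q i (x i)) := by
  have hp : ∀ i, IsProbabilityMeasure ((P i).map (T i)) := fun i =>
    Measure.isProbabilityMeasure_map (hT i).aemeasurable
  have hp' : ∀ i, IsProbabilityMeasure ((P i).withDensity (q i)) := fun i => h i ▸ hp i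
  rw [Measure.pi_map_pi (fun i => (hT i).aemeasurable), ← pi_withDensity P hq]
  simp_rw [h]

theorem gaussianReal_map_add_eq_withDensity (t : ℝ) :
    (gaussianReal 0 1).map (fun x => x + t) =
      (gaussianReal 0 1).withDensity (fun x => ENNReal.ofReal (Real.exp (t * x - t ^ 2 / 2))) := by
  rw [gaussianReal_map_add_const, gaussianReal_of_var_ne_zero _ one_ne_zero,
    gaussianReal_of_var_ne_zero _ one_ne_zero, ← withDensity_mul _ (measurable_gaussianPDF _ _)
      (by fun_prop)]
  congr 1
  ext x
  simp only [Pi.mul_apply, gaussianPDF_def]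
  rw [← ENNReal.ofReal_mul (gaussianPDFReal_nonneg _ _ _)]
  congr 1
  simp only [gaussianPDFReal_def, zero_add, sub_zero, mul_assoc, ← Real.exp_add]
  congr 2
  push_cast
  ring_nf

section shift

variable {n d : ℕ}

/-- The law of `n` independent standard Gaussian vectors. -/
noncomputable abbrev stdLaw (n d : ℕ) : Measure (Fin n → EuclideanSpace ℝ (Fin d)) :=
  Measure.pi (fun _ => stdGaussian (EuclideanSpace ℝ (Fin d)))

/-- Move the `j`-th coordinate of a vector by `t`. -/
noncomputable def coordShift (j : Fin d) (t : ℝ) (x : EuclideanSpace ℝ (Fin d)) :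
    EuclideanSpace ℝ (Fin d) :=
  x + EuclideanSpace.single j t

theorem measurable_coordShift (j : Fin d) (t : ℝ) : Measurable (coordShift j t) := by
  unfold coordShift; fun_prop

theorem stdGaussian_map_coordShift (j : Fin d) (t : ℝ) :
    (stdGaussian (EuclideanSpace ℝ (Fin d))).map (coordShift j t) =
      (stdGaussian (EuclideanSpace ℝ (Fin d))).withDensity
        (fun x => ENNReal.ofReal (Real.exp (t * x j - t ^ 2 / 2))) := by
  have key := pi_map_eq_withDensity (fun _ : Fin d => gaussianReal 0 1)
    (q := fun i x => ENNReal.ofReal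
      (Real.exp ((Pi.single j t : Fin d → ℝ) i * x - (Pi.single j t : Fin d → ℝ) i ^ 2 / 2)))
    (T := fun i x => x + (Pi.single j t : Fin d → ℝ) i)
    (fun i => by fun_prop) (fun i => by fun_prop)
    (fun i => gaussianReal_map_add_eq_withDensity _)
  have hprod : ∀ x : Fin d → ℝ, ∏ i, ENNReal.ofReal
      (Real.exp ((Pi.single j t : Fin d → ℝ) i * x i - (Pi.single j t : Fin d → ℝ) i ^ 2 / 2)) =
      ENNReal.ofReal (Real.exp (t * x j - t ^ 2 / 2)) := by
    intro x
    rw [Finset.prod_eq_single j]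
    · simp
    · intro i _ hi
      simp [Pi.single_eq_of_ne hi]
    · simp
  simp_rw [hprod] at key
  rw [← map_pi_eq_stdGaussian, Measure.map_map (measurable_coordShift j t) (by fun_prop)]
  have hcomp : coordShift j t ∘ WithLp.toLp 2 =
      WithLp.toLp 2 ∘ (fun (x : Fin d → ℝ) i => x i + (Pi.single j t : Fin d → ℝ) i) := by
    ext x i
    simp [coordShift, Pi.single_apply]
  rw [hcomp, ← Measure.map_map (by fun_prop) (by fun_prop), key]
  ext s hs
  rw [Measure.map_apply (by fun_prop) hs, withDensity_apply _ (by measurability),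
    withDensity_apply _ hs, Measure.restrict_map (by fun_prop) hs,
    lintegral_map (by fun_prop) (by fun_prop)]

/-- Move the `j`-th coordinate of the `i`-th sample by `θ i`. -/
noncomputable def sampleShift (j : Fin d) (θ : Fin n → ℝ)
    (x : Fin n → EuclideanSpace ℝ (Fin d)) : Fin n → EuclideanSpace ℝ (Fin d) :=
  fun i => coordShift j (θ i) (x i)

/-- The likelihood ratio of `sampleShift`. -/
noncomputable def shiftDensity (j : Fin d) (θ : Fin n → ℝ)
    (x : Fin n → EuclideanSpace ℝ (Fin d)) : ℝ :=
  Real.exp (∑ i, (θ i * x i j - θ i ^ 2 / 2))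

theorem measurable_sampleShift (j : Fin d) (θ : Fin n → ℝ) : Measurable (sampleShift j θ) :=
  measurable_pi_lambda _ fun i => (measurable_coordShift j (θ i)).comp (measurable_pi_apply i)

theorem measurable_shiftDensity (j : Fin d) (θ : Fin n → ℝ) : Measurable (shiftDensity j θ) := by
  unfold shiftDensity; fun_prop

theorem shiftDensity_pos (j : Fin d) (θ : Fin n → ℝ) (x) : 0 < shiftDensity j θ x :=
  Real.exp_pos _

theorem stdLaw_map_sampleShift (j : Fin d) (θ : Fin n → ℝ) :
    (stdLaw n d).map (sampleShift j θ) =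
      (stdLaw n d).withDensity (fun x => ENNReal.ofReal (shiftDensity j θ x)) := by
  have key := pi_map_eq_withDensity (fun _ : Fin n => stdGaussian (EuclideanSpace ℝ (Fin d)))
    (q := fun i x => ENNReal.ofReal (Real.exp (θ i * x j - θ i ^ 2 / 2)))
    (T := fun i => coordShift j (θ i))
    (fun i => by fun_prop) (fun i => measurable_coordShift _ _)
    (fun i => stdGaussian_map_coordShift _ _)
  refine key.trans ?_
  congr 1
  ext x
  rw [shiftDensity, Real.exp_sum, ENNReal.ofReal_prod_of_nonneg fun i _ => (Real.exp_pos _).le]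

theorem integral_comp_sampleShift (j : Fin d) (θ : Fin n → ℝ)
    {G : (Fin n → EuclideanSpace ℝ (Fin d)) → ℝ} (hG : Measurable G) :
    ∫ x, G (sampleShift j θ x) ∂(stdLaw n d) = ∫ x, shiftDensity j θ x * G x ∂(stdLaw n d) := by
  rw [← integral_map (measurable_sampleShift j θ).aemeasurable hG.aestronglyMeasurable,
    stdLaw_map_sampleShift, integral_withDensity_eq_integral_toReal_smul
      (measurable_shiftDensity j θ).ennreal_ofReal (by simp)]
  simp [ENNReal.toReal_ofReal (shiftDensity_pos j θ _).le]

theorem lintegral_shiftDensity (j : Fin d) (θ : Fin n → ℝ) :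
    ∫⁻ x, ENNReal.ofReal (shiftDensity j θ x) ∂(stdLaw n d) = 1 := by
  have h := congrArg (fun m => m Set.univ) (stdLaw_map_sampleShift j θ)
  simp only [withDensity_apply _ MeasurableSet.univ, Measure.restrict_univ] at h
  rw [← h, Measure.map_apply (measurable_sampleShift j θ) MeasurableSet.univ]
  simp

theorem integrable_shiftDensity (j : Fin d) (θ : Fin n → ℝ) :
    Integrable (shiftDensity j θ) (stdLaw n d) := by
  refine ⟨(measurable_shiftDensity j θ).aestronglyMeasurable, ?_⟩
  rw [hasFiniteIntegral_iff_ofReal (.of_forall fun x => (shiftDensity_pos j θ x).le),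
    lintegral_shiftDensity]
  simp

theorem integral_shiftDensity (j : Fin d) (θ : Fin n → ℝ) :
    ∫ x, shiftDensity j θ x ∂(stdLaw n d) = 1 := by
  rw [integral_eq_lintegral_of_nonneg_ae (.of_forall fun x => (shiftDensity_pos j θ x).le)
    (measurable_shiftDensity j θ).aestronglyMeasurable, lintegral_shiftDensity]
  simp

/-- Completing the square. It makes every `L²` computation with likelihood ratios a matter of inner
products of shift vectors. -/
theorem shiftDensity_mul (j : Fin d) (θ θ' : Fin n → ℝ) (x) :
    shiftDensity j θ x * shiftDensity j θ' x =
      Real.exp (∑ i, θ i * θ' i) * shiftDensity j (θ + θ') x := by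
  simp only [shiftDensity, ← Real.exp_add, ← Finset.sum_add_distrib, Pi.add_apply]
  congr 1
  exact Finset.sum_congr rfl fun i _ => by ring

theorem memLp_shiftDensity (j : Fin d) (θ : Fin n → ℝ) :
    MemLp (shiftDensity j θ) 2 (stdLaw n d) := by
  rw [memLp_two_iff_integrable_sq (measurable_shiftDensity j θ).aestronglyMeasurable]
  simp_rw [sq, shiftDensity_mul]
  exact (integrable_shiftDensity j _).const_mul _

theorem integral_shiftDensity_mul (j : Fin d) (θ θ' : Fin n → ℝ) :
    ∫ x, shiftDensity j θ x * shiftDensity j θ' x ∂(stdLaw n d) =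
      Real.exp (∑ i, θ i * θ' i) := by
  simp_rw [shiftDensity_mul]
  rw [integral_const_mul, integral_shiftDensity, mul_one]

theorem memLp_shiftDensity_sub_one (j : Fin d) (θ : Fin n → ℝ) :
    MemLp (fun x => shiftDensity j θ x - 1) 2 (stdLaw n d) :=
  (memLp_shiftDensity j θ).sub (memLp_const 1)

theorem integral_shiftDensity_sub_one_mul (j : Fin d) (θ θ' : Fin n → ℝ) :
    ∫ x, (shiftDensity j θ x - 1) * (shiftDensity j θ' x - 1) ∂(stdLaw n d) =
      Real.exp (∑ i, θ i * θ' i) - 1 := by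
  have h : ∀ x, (shiftDensity j θ x - 1) * (shiftDensity j θ' x - 1) =
      shiftDensity j θ x * shiftDensity j θ' x - shiftDensity j θ x - shiftDensity j θ' x + 1 :=
    fun x => by ring
  have i1 : Integrable (fun x => shiftDensity j θ x * shiftDensity j θ' x) (stdLaw n d) :=
    (memLp_shiftDensity j θ).integrable_mul (memLp_shiftDensity j θ')
  have i2 := integrable_shiftDensity j θ
  have i3 := integrable_shiftDensity j θ'
  have i12 : Integrable (fun x => shiftDensity j θ x * shiftDensity j θ' x - shiftDensity j θ x)
      (stdLaw n d) := i1.sub i2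
  have i123 : Integrable (fun x => shiftDensity j θ x * shiftDensity j θ' x - shiftDensity j θ x
      - shiftDensity j θ' x) (stdLaw n d) := i12.sub i3
  simp_rw [h]
  rw [integral_add i123 (integrable_const 1), integral_sub i12 i3,
    integral_sub i1 i2, integral_shiftDensity_mul, integral_shiftDensity, integral_shiftDensity]
  simp

/-- The `L²` distance between a centered density and a combination of centered densities. -/
theorem integral_sq_shiftDensity_sub_sum {A : Type*} [Fintype A] (j : Fin d) (θ : Fin n → ℝ)
    (w : ℝ) (φ : A → Fin n → ℝ) :
    ∫ x, ((shiftDensity j θ x - 1) - w * ∑ a, (shiftDensity j (φ a) x - 1)) ^ 2 ∂(stdLaw n d) =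
      (Real.exp (∑ i, θ i * θ i) - 1) - 2 * w * ∑ a, (Real.exp (∑ i, θ i * φ a i) - 1)
        + w ^ 2 * ∑ a, ∑ b, (Real.exp (∑ i, φ a i * φ b i) - 1) := by
  have hL := fun θ : Fin n → ℝ => memLp_shiftDensity_sub_one j θ
  have h : ∀ x, ((shiftDensity j θ x - 1) - w * ∑ a, (shiftDensity j (φ a) x - 1)) ^ 2 =
      (shiftDensity j θ x - 1) * (shiftDensity j θ x - 1)
      - 2 * w * ∑ a, (shiftDensity j θ x - 1) * (shiftDensity j (φ a) x - 1)
      + w ^ 2 * ∑ a, ∑ b, (shiftDensity j (φ a) x - 1) * (shiftDensity j (φ b) x - 1) := by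
    intro x
    rw [← Finset.mul_sum, ← Finset.sum_mul_sum]
    ring
  have i0 : ∀ θ θ' : Fin n → ℝ, Integrable
      (fun x => (shiftDensity j θ x - 1) * (shiftDensity j θ' x - 1)) (stdLaw n d) :=
    fun θ θ' => (hL θ).integrable_mul (hL θ')
  have i1 : Integrable (fun x => ∑ a, (shiftDensity j θ x - 1) * (shiftDensity j (φ a) x - 1))
      (stdLaw n d) := integrable_finsetSum _ fun a _ => i0 _ _
  have i2 : Integrable (fun x => ∑ a, ∑ b,
      (shiftDensity j (φ a) x - 1) * (shiftDensity j (φ b) x - 1)) (stdLaw n d) :=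
    integrable_finsetSum _ fun a _ => integrable_finsetSum _ fun b _ => i0 _ _
  have i3 : Integrable (fun x => (shiftDensity j θ x - 1) * (shiftDensity j θ x - 1)
      - 2 * w * ∑ a, (shiftDensity j θ x - 1) * (shiftDensity j (φ a) x - 1)) (stdLaw n d) :=
    (i0 θ θ).sub (i1.const_mul _)
  simp_rw [h]
  rw [integral_add i3 (i2.const_mul _),
    integral_sub (i0 θ θ) (i1.const_mul _), integral_const_mul, integral_const_mul,
    integral_finsetSum _ (fun a _ => i0 _ _),
    integral_finsetSum _ (fun a _ => integrable_finsetSum _ fun b _ => i0 _ _)]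
  simp_rw [integral_finsetSum _ (fun b _ => i0 _ _),
    integral_shiftDensity_sub_one_mul]

end shift

/-! ### Cauchy–Schwarz for finite families -/

theorem integral_mul_le_sqrt_mul_sqrt {Ω : Type*} [MeasurableSpace Ω] {m : Measure Ω}
    {u v : Ω → ℝ} (hu : MemLp u 2 m) (hv : MemLp v 2 m) :
    ∫ x, u x * v x ∂m ≤ √(∫ x, u x ^ 2 ∂m) * √(∫ x, v x ^ 2 ∂m) := by
  have h2 : ENNReal.ofReal 2 = 2 := by simp
  have h := integral_mul_norm_le_Lp_mul_Lq (μ := m) (f := u) (g := v) Real.HolderConjugate.two_two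
    (by rwa [h2]) (by rwa [h2])
  have e : ∀ w : Ω → ℝ, (∫ x, ‖w x‖ ^ (2 : ℝ) ∂m) ^ (1 / 2 : ℝ) = √(∫ x, w x ^ 2 ∂m) := by
    intro w
    rw [← Real.sqrt_eq_rpow]
    simp
  rw [e, e] at h
  refine le_trans (integral_mono (hu.integrable_mul hv) ?_ fun x => ?_) h
  · exact hu.norm.integrable_mul hv.norm
  · rw [← norm_mul]; exact Real.le_norm_self _

/-- Cauchy–Schwarz in the integral and then in `j`: only the totals over all coordinates enter, so
the total error bound `C d / n` is not spent anew on each coordinate. -/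
theorem sum_integral_mul_le {ι Ω : Type*} [Fintype ι] [MeasurableSpace Ω] {m : ι → Measure Ω}
    {u v : ι → Ω → ℝ} (hu : ∀ j, MemLp (u j) 2 (m j)) (hv : ∀ j, MemLp (v j) 2 (m j)) {a b : ℝ}
    (ha : ∑ j, ∫ x, u j x ^ 2 ∂(m j) ≤ a) (hb : ∑ j, ∫ x, v j x ^ 2 ∂(m j) ≤ b) :
    ∑ j, ∫ x, u j x * v j x ∂(m j) ≤ √a * √b := by
  calc ∑ j, ∫ x, u j x * v j x ∂(m j)
      ≤ ∑ j, √(∫ x, u j x ^ 2 ∂(m j)) * √(∫ x, v j x ^ 2 ∂(m j)) :=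
        Finset.sum_le_sum fun j _ => integral_mul_le_sqrt_mul_sqrt (hu j) (hv j)
    _ ≤ √(∑ j, ∫ x, u j x ^ 2 ∂(m j)) * √(∑ j, ∫ x, v j x ^ 2 ∂(m j)) :=
        Real.sum_sqrt_mul_sqrt_le _ (fun j => integral_nonneg fun x => sq_nonneg _)
          (fun j => integral_nonneg fun x => sq_nonneg _)
    _ ≤ √a * √b := by gcongr

/-- The coordinates of a square integrable vector. -/
theorem coord_memLp_and_sum_le {d : ℕ} {Ω : Type*} [MeasurableSpace Ω] {m : Measure Ω}
    {D : Ω → EuclideanSpace ℝ (Fin d)} (hD : Measurable D) {a : ℝ} (ha : 0 ≤ a)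
    (h : ∫⁻ x, ‖D x‖ₑ ^ 2 ∂m ≤ ENNReal.ofReal a) :
    (∀ j, MemLp (fun x => D x j) 2 m) ∧ ∑ j, ∫ x, D x j ^ 2 ∂m ≤ a := by
  have hL : MemLp D 2 m := by
    refine ⟨hD.aestronglyMeasurable, ?_⟩
    rw [eLpNorm_lt_top_iff_lintegral_rpow_enorm_lt_top (by simp) (by simp)]
    simp only [ENNReal.toReal_ofNat, ENNReal.rpow_ofNat]
    exact h.trans_lt ENNReal.ofReal_lt_top
  have hc : ∀ j, MemLp (fun x => D x j) 2 m := fun j =>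
    hL.of_le (by fun_prop) (.of_forall fun x => PiLp.norm_apply_le _ _)
  refine ⟨hc, ?_⟩
  rw [← integral_finsetSum _ fun j _ => (hc j).integrable_sq]
  simp_rw [← EuclideanSpace.real_norm_sq_eq]
  rw [integral_eq_lintegral_of_nonneg_ae (.of_forall fun x => by positivity) (by fun_prop)]
  refine ENNReal.toReal_le_of_le_ofReal ha (le_trans (le_of_eq ?_) h)
  refine lintegral_congr fun x => ?_
  rw [ENNReal.ofReal_pow (norm_nonneg _), ofReal_norm]

/-! ### Averaging discrete divergences over a large box -/

/-- Sum over a grid of step `δ` with `T ^ d` points. Along each line in direction `j` the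
differences telescope, leaving boundary terms of total size at most `2 β d T ^ (d - 1)`, which `T ^
d κ` outgrows if `κ > 0`. No regularity of `w` in `μ` is needed. -/
theorem nonpos_of_le_sum_differences {d : ℕ} (δ β κ : ℝ)
    (w : Fin d → EuclideanSpace ℝ (Fin d) → ℝ) (hw : ∀ j μ, |w j μ| ≤ β)
    (h : ∀ μ, κ ≤ ∑ j, (w j (μ + EuclideanSpace.single j δ) - w j μ)) : κ ≤ 0 := by
  rcases Nat.eq_zero_or_pos d with rfl | hd
  · simpa using h 0
  by_contra! hκ
  have main : ∀ T : ℕ, 0 < T → T * κ ≤ 2 * β * d := by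
    intro T hT
    let pt : (Fin d → Fin T) → EuclideanSpace ℝ (Fin d) :=
      fun m => WithLp.toLp 2 fun i => δ * (m i : ℕ)
    have h1 : (T : ℝ) ^ d * κ ≤
        ∑ m : Fin d → Fin T, ∑ j, (w j (pt m + EuclideanSpace.single j δ) - w j (pt m)) := by
      calc (T : ℝ) ^ d * κ = ∑ m : Fin d → Fin T, κ := by simp
        _ ≤ _ := Finset.sum_le_sum fun m _ => h (pt m)
    rw [Finset.sum_comm] at h1
    have h2 : ∀ j : Fin d, ∑ m : Fin d → Fin T,
        (w j (pt m + EuclideanSpace.single j δ) - w j (pt m)) ≤ 2 * β * (T : ℝ) ^ (d - 1) := by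
      intro j
      -- Splitting off the `j`-th grid coordinate turns the sum into one over lines parallel to
      -- `e_j`.
      rw [← (Equiv.funSplitAt j (Fin T)).symm.sum_comp, Fintype.sum_prod_type, Finset.sum_comm]
      calc _ ≤ ∑ y : {i // i ≠ j} → Fin T, 2 * β := by
            refine Finset.sum_le_sum fun y _ => ?_
            let g : ℕ → ℝ := fun t => w j (WithLp.toLp 2 fun i =>
              if hi : i = j then δ * t else δ * (y ⟨i, hi⟩ : ℕ))
            have hg : ∀ t : Fin T,
                w j (pt ((Equiv.funSplitAt j (Fin T)).symm (t, y)) + EuclideanSpace.single j δ) -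
                  w j (pt ((Equiv.funSplitAt j (Fin T)).symm (t, y))) =
                g ((t : ℕ) + 1) - g (t : ℕ) := by
              intro t
              congr 2
              · ext i
                by_cases hi : i = j
                · subst hi
                  simp [pt, Equiv.funSplitAt]; ring
                · simp [pt, Equiv.funSplitAt, hi]
              · ext i
                by_cases hi : i = j
                · subst hi
                  simp [pt, Equiv.funSplitAt]
                · simp [pt, Equiv.funSplitAt, hi]
            simp_rw [hg]
            rw [Fin.sum_univ_eq_sum_range (fun t => g (t + 1) - g t), Finset.sum_range_sub]
            have b1 := abs_le.1 (hw j (WithLp.toLp 2 fun i =>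
              if hi : i = j then δ * T else δ * (y ⟨i, hi⟩ : ℕ)))
            have b2 := abs_le.1 (hw j (WithLp.toLp 2 fun i =>
              if hi : i = j then δ * (0 : ℕ) else δ * (y ⟨i, hi⟩ : ℕ)))
            simp only [g]
            linarith [b1.2, b2.1]
        _ = 2 * β * (T : ℝ) ^ (d - 1) := by
            simp [Fintype.card_subtype_compl, mul_comm]
    have h3 : (T : ℝ) ^ d * κ ≤ d * (2 * β * (T : ℝ) ^ (d - 1)) := by
      refine h1.trans ((Finset.sum_le_sum fun j _ => h2 j).trans ?_)
      simp
    have hTd : (T : ℝ) ^ d = T * (T : ℝ) ^ (d - 1) := by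
      rw [← pow_succ', Nat.sub_add_cancel hd]
    rw [hTd] at h3
    have hpos : (0 : ℝ) < (T : ℝ) ^ (d - 1) := by positivity
    refine le_of_mul_le_mul_right ?_ hpos
    linarith
  obtain ⟨T, hT⟩ := exists_nat_gt (2 * β * d / κ)
  have hβ : 0 ≤ β := (abs_nonneg _).trans (hw ⟨0, hd⟩ 0)
  have hT0 : 0 < T := by
    have : (0 : ℝ) < T := lt_of_le_of_lt (by positivity) hT
    exact_mod_cast this
  have := main T hT0
  rw [div_lt_iff₀ hκ] at hT
  linarith

/-! ### Centered estimators -/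

variable {n d : ℕ}

/-- The error of `f` at mean `μ`, as a function of standard Gaussian noise. -/
noncomputable def centered (f : (Fin n → EuclideanSpace ℝ (Fin d)) → EuclideanSpace ℝ (Fin d))
    (μ : EuclideanSpace ℝ (Fin d)) (x : Fin n → EuclideanSpace ℝ (Fin d)) :
    EuclideanSpace ℝ (Fin d) :=
  f (fun i => x i + μ) - μ

open Classical in
/-- `f` has mean squared error at most `C d / n` and its changes under `k` replacements are
bounded in mean square by `r ^ 2`, uniformly in the mean. -/
structure SensitivityBound (k : ℕ) (C r : ℝ)
    (f : (Fin n → EuclideanSpace ℝ (Fin d)) → EuclideanSpace ℝ (Fin d)) : Prop where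
  measurable : Measurable f
  accurate : ∀ μ, ∫⁻ x, ‖centered f μ x‖ₑ ^ 2 ∂(stdLaw n d) ≤ ENNReal.ofReal (C * (d / n))
  sensitive : ∀ μ, ∃ S : (Fin n → EuclideanSpace ℝ (Fin d)) → ℝ≥0∞,
    (∀ x x', (Finset.univ.filter fun i => x i ≠ x' i).card ≤ k →
      ‖centered f μ x - centered f μ x'‖ₑ ≤ S x) ∧
    ∫⁻ x, S x ^ 2 ∂(stdLaw n d) ≤ ENNReal.ofReal (r ^ 2)

theorem measurable_centered {f : (Fin n → EuclideanSpace ℝ (Fin d)) → EuclideanSpace ℝ (Fin d)}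
    (hf : Measurable f) (μ : EuclideanSpace ℝ (Fin d)) : Measurable (centered f μ) := by
  unfold centered
  exact (hf.comp (by fun_prop)).sub_const μ

theorem centered_sampleShift
    (f : (Fin n → EuclideanSpace ℝ (Fin d)) → EuclideanSpace ℝ (Fin d))
    (μ : EuclideanSpace ℝ (Fin d)) (j : Fin d) (δ : ℝ) (x) :
    centered f μ (sampleShift j (fun _ => δ) x) =
      centered f (μ + EuclideanSpace.single j δ) x + EuclideanSpace.single j δ := by
  have : (fun i => coordShift j δ (x i) + μ) = fun i => x i + (μ + EuclideanSpace.single j δ) := by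
    ext1 i
    simp only [coordShift]
    abel
  simp only [centered, sampleShift, this]
  abel

namespace SensitivityBound

variable {k : ℕ} {C r : ℝ}
  {f : (Fin n → EuclideanSpace ℝ (Fin d)) → EuclideanSpace ℝ (Fin d)}

theorem memLp_coord (h : SensitivityBound k C r f) (hC : 0 ≤ C) (μ) (j : Fin d) :
    MemLp (fun x => centered f μ x j) 2 (stdLaw n d) :=
  (coord_memLp_and_sum_le (measurable_centered h.measurable μ) (by positivity)
    (h.accurate μ)).1 j

theorem sum_integral_sq_le (h : SensitivityBound k C r f) (hC : 0 ≤ C) (μ) :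
    ∑ j, ∫ x, centered f μ x j ^ 2 ∂(stdLaw n d) ≤ C * (d / n) :=
  (coord_memLp_and_sum_le (measurable_centered h.measurable μ) (by positivity)
    (h.accurate μ)).2

theorem integral_sq_le (h : SensitivityBound k C r f) (hC : 0 ≤ C) (μ) (j : Fin d) :
    ∫ x, centered f μ x j ^ 2 ∂(stdLaw n d) ≤ C * (d / n) :=
  (Finset.single_le_sum (f := fun j => ∫ x, centered f μ x j ^ 2 ∂(stdLaw n d))
    (fun _ _ => integral_nonneg fun _ => sq_nonneg _) (Finset.mem_univ j)).trans
    (h.sum_integral_sq_le hC μ)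

theorem abs_integral_le (h : SensitivityBound k C r f) (hC : 0 ≤ C) (μ) (j : Fin d) :
    |∫ x, centered f μ x j ∂(stdLaw n d)| ≤ √(C * (d / n)) := by
  have key : ∀ u : (Fin n → EuclideanSpace ℝ (Fin d)) → ℝ, MemLp u 2 (stdLaw n d) →
      ∫ x, u x ^ 2 ∂(stdLaw n d) ≤ C * (d / n) → ∫ x, u x ∂(stdLaw n d) ≤ √(C * (d / n)) := by
    intro u hu hle
    have := integral_mul_le_sqrt_mul_sqrt hu (memLp_const (1 : ℝ))
    simp only [mul_one, one_pow, integral_const, probReal_univ, smul_eq_mul,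
      Real.sqrt_one] at this
    exact this.trans (Real.sqrt_le_sqrt hle)
  rw [abs_le']
  refine ⟨key _ (h.memLp_coord hC μ j) (h.integral_sq_le hC μ j), ?_⟩
  rw [← integral_neg]
  exact key _ (h.memLp_coord hC μ j).neg (by simpa using h.integral_sq_le hC μ j)

/-- Translating all the noise by `δ e_j` is the same as moving the mean, apart from the recentering,
which contributes `δ`. -/
theorem integral_shift (h : SensitivityBound k C r f) (hC : 0 ≤ C) (μ) (j : Fin d) (δ : ℝ) :
    ∫ x, centered f μ x j * (shiftDensity j (fun _ => δ) x - 1) ∂(stdLaw n d) =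
      δ + (∫ x, centered f (μ + EuclideanSpace.single j δ) x j ∂(stdLaw n d)
        - ∫ x, centered f μ x j ∂(stdLaw n d)) := by
  have hi : ∀ μ, Integrable (fun x => centered f μ x j) (stdLaw n d) := fun μ =>
    (h.memLp_coord hC μ j).integrable (by norm_num)
  have hm := measurable_centered h.measurable μ
  have e := integral_comp_sampleShift j (fun _ : Fin n => δ)
    (G := fun x => centered f μ x j) (by fun_prop)
  simp only [centered_sampleShift, PiLp.add_apply, PiLp.single_apply, if_true] at e
  rw [integral_add (hi _) (integrable_const _), integral_const, probReal_univ, one_smul] at e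
  simp_rw [mul_sub, mul_one]
  rw [integral_sub ?_ (hi μ)]
  · simp_rw [mul_comm (centered f μ _ j)]
    rw [← e]; ring
  · exact (h.memLp_coord hC μ j).integrable_mul (memLp_shiftDensity j _)

/-- If `H j` approximates the centered likelihood ratio of a translation by `δ` in direction `j`,
then the correlations of the errors of `f` with the `H j` sum up to almost `d δ` for some mean. -/
theorem le_of_approx (h : SensitivityBound k C r f) (hC : 0 ≤ C) {δ ρ B : ℝ} (hρ : 0 ≤ ρ)
    {H : Fin d → (Fin n → EuclideanSpace ℝ (Fin d)) → ℝ}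
    (hH : ∀ j, MemLp (H j) 2 (stdLaw n d))
    (hHρ : ∀ j, ∫ x, ((shiftDensity j (fun _ => δ) x - 1) - H j x) ^ 2 ∂(stdLaw n d) ≤ ρ ^ 2)
    (hB : ∀ μ, ∑ j, ∫ x, centered f μ x j * H j x ∂(stdLaw n d) ≤ B) :
    d * (δ - √(C / n) * ρ) ≤ B := by
  have hsub : ∀ j, MemLp (fun x => (shiftDensity j (fun _ => δ) x - 1) - H j x) 2 (stdLaw n d) :=
    fun j => (memLp_shiftDensity_sub_one j _).sub (hH j)
  have hs : √(C * (d / n)) * √(d * ρ ^ 2) = d * (√(C / n) * ρ) := by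
    rw [← Real.sqrt_mul (by positivity),
      show C * (d / n) * (d * ρ ^ 2) = (C / n) * (d * ρ) ^ 2 by ring,
      Real.sqrt_mul (by positivity), Real.sqrt_sq (by positivity)]
    ring
  -- The field is minus the bias, so its divergence is what remains of `d δ` after subtracting the
  -- correlations.
  have key := nonpos_of_le_sum_differences δ (√(C * (d / n))) (d * (δ - √(C / n) * ρ) - B)
    (fun j μ => -∫ x, centered f μ x j ∂(stdLaw n d))
    (fun j μ => by rw [abs_neg]; exact h.abs_integral_le hC μ j) ?_
  · linarith
  intro μ
  have h1 : ∑ j, ∫ x, centered f μ x j * ((shiftDensity j (fun _ => δ) x - 1) - H j x)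
      ∂(stdLaw n d) ≤ √(C * (d / n)) * √(d * ρ ^ 2) :=
    sum_integral_mul_le (fun j => h.memLp_coord hC μ j) hsub (h.sum_integral_sq_le hC μ)
      ((Finset.sum_le_sum fun j _ => hHρ j).trans (by simp))
  have h2 : ∀ j, ∫ x, centered f μ x j * ((shiftDensity j (fun _ => δ) x - 1) - H j x)
      ∂(stdLaw n d) = δ + (∫ x, centered f (μ + EuclideanSpace.single j δ) x j ∂(stdLaw n d)
        - ∫ x, centered f μ x j ∂(stdLaw n d)) - ∫ x, centered f μ x j * H j x ∂(stdLaw n d) := by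
    intro j
    rw [← h.integral_shift hC μ j δ, ← integral_sub]
    · simp_rw [mul_sub]
    · exact (h.memLp_coord hC μ j).integrable_mul (memLp_shiftDensity_sub_one j _)
    · exact (h.memLp_coord hC μ j).integrable_mul (hH j)
  simp_rw [h2, hs] at h1
  rw [Finset.sum_sub_distrib, Finset.sum_add_distrib, Finset.sum_sub_distrib] at h1
  simp only [Finset.sum_const, Finset.card_univ, Fintype.card_fin, nsmul_eq_mul] at h1
  have h3 := hB μ
  simp only [neg_sub_neg]
  rw [Finset.sum_sub_distrib]
  linarith

end SensitivityBound

/-! ### Elementary bounds on the exponential -/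

theorem exp_sub_one_sub_id_le_sq {y : ℝ} (h0 : 0 ≤ y) (h1 : y ≤ 1) :
    Real.exp y - 1 - y ≤ y ^ 2 :=
  (le_abs_self _).trans (Real.abs_exp_sub_one_sub_id_le (by rwa [abs_of_nonneg h0]))

theorem exp_sub_one_le_two_mul {y : ℝ} (h0 : 0 ≤ y) (h1 : y ≤ 1) : Real.exp y - 1 ≤ 2 * y := by
  nlinarith [exp_sub_one_sub_id_le_sq h0 h1]

namespace SensitivityBound

variable {k : ℕ} {C r : ℝ}
  {f : (Fin n → EuclideanSpace ℝ (Fin d)) → EuclideanSpace ℝ (Fin d)}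

open Classical in
theorem sub_comp_memLp_and_sum_le (h : SensitivityBound k C r f) (μ)
    {T : (Fin n → EuclideanSpace ℝ (Fin d)) → Fin n → EuclideanSpace ℝ (Fin d)}
    (hT : Measurable T) (hk : ∀ x, (Finset.univ.filter fun i => x i ≠ T x i).card ≤ k) :
    (∀ j, MemLp (fun x => centered f μ x j - centered f μ (T x) j) 2 (stdLaw n d)) ∧
      ∑ j, ∫ x, (centered f μ x j - centered f μ (T x) j) ^ 2 ∂(stdLaw n d) ≤ r ^ 2 := by
  obtain ⟨S, hS, hSr⟩ := h.sensitive μ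
  have hm := measurable_centered h.measurable μ
  refine coord_memLp_and_sum_le (D := fun x => centered f μ x - centered f μ (T x))
    (hm.sub (hm.comp hT)) (sq_nonneg r) (le_trans (lintegral_mono fun x => ?_) hSr)
  exact pow_le_pow_left' (hS x (T x) (hk x)) 2

/-! ### Correlation with blocks of samples -/

/-- To first order in `δ`, the centered likelihood ratio of the full translation is the sum of those
of its blocks, and each block can be erased with at most `k` changes. -/
theorem sqrt_dim_le (h : SensitivityBound k C r f) (hC : 0 ≤ C) (hr : 0 ≤ r) (hn : 0 < n)
    (hd : 0 < d) (hkn : k ≤ n) {M : ℕ} (blk : Fin n → Fin M)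
    (hblk : ∀ l, (Finset.univ.filter fun i => blk i = l).card ≤ k) :
    √d ≤ 2 * M * √(2 * k) * r := by
  classical
  have hn' : (0 : ℝ) < n := by exact_mod_cast hn
  have hsn : 0 < √(n : ℝ) := Real.sqrt_pos.2 hn'
  -- Chosen so that `n δ² ≤ 1` and the approximation loss `√(C / n) * (n * δ ^ 2)` is at most `δ /
  -- 2`.
  set δ : ℝ := 1 / (√n * (2 * √C + 1)) with hδ
  have hδ0 : 0 < δ := by positivity
  have hδ1 : √n * δ * (2 * √C + 1) = 1 := by rw [hδ]; field_simp
  have hnδ : (n : ℝ) * δ ^ 2 = (√n * δ) ^ 2 := by rw [mul_pow, Real.sq_sqrt hn'.le]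
  have hsδ : √n * δ ≤ 1 := by
    nlinarith [Real.sqrt_nonneg C, mul_nonneg (mul_pos hsn hδ0).le (Real.sqrt_nonneg C)]
  have hy0 : (0 : ℝ) ≤ n * δ ^ 2 := by positivity
  have hy1 : (n : ℝ) * δ ^ 2 ≤ 1 := by rw [hnδ]; exact pow_le_one₀ (by positivity) hsδ
  let φ : Fin M → Fin n → ℝ := fun l i => if blk i = l then δ else 0
  have hcard : ∀ l, ∑ i, φ l i * φ l i = (Finset.univ.filter fun i => blk i = l).card * δ ^ 2 := by
    intro l
    have : ∀ i, φ l i * φ l i = if blk i = l then δ ^ 2 else 0 := by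
      intro i
      by_cases hi : blk i = l <;> simp [φ, hi, sq]
    simp_rw [this]
    rw [← Finset.sum_filter, Finset.sum_const, nsmul_eq_mul]
  have hcard' : ∀ l, ∑ i, δ * φ l i = (Finset.univ.filter fun i => blk i = l).card * δ ^ 2 := by
    intro l
    have : ∀ i, δ * φ l i = if blk i = l then δ ^ 2 else 0 := by
      intro i
      by_cases hi : blk i = l <;> simp [φ, hi, sq]
    simp_rw [this]
    rw [← Finset.sum_filter, Finset.sum_const, nsmul_eq_mul]
  have hkδ : ∀ l, Real.exp (∑ i, φ l i * φ l i) - 1 ≤ 2 * (k * δ ^ 2) := by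
    intro l
    have h1 : ((Finset.univ.filter fun i => blk i = l).card : ℝ) ≤ k := by exact_mod_cast hblk l
    have h2 : (k : ℝ) ≤ n := by exact_mod_cast hkn
    rw [hcard]
    refine (exp_sub_one_le_two_mul (by positivity) ?_).trans (by gcongr)
    exact le_trans (by gcongr; exact (hblk l).trans hkn) hy1
  have key := h.le_of_approx hC (δ := δ) (ρ := n * δ ^ 2) (B := M * (r * √(d * (2 * (k * δ ^ 2)))))
    hy0 (H := fun j x => ∑ l, (shiftDensity j (φ l) x - 1))
    (fun j => memLp_finsetSum _ fun l _ => memLp_shiftDensity_sub_one j _) ?_ ?_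
  · have h1 : √(C / n) * (n * δ ^ 2) ≤ δ / 2 := by
      have : √(C / n) * (n * δ ^ 2) = √C * (√n * δ) * δ := by
        rw [Real.sqrt_div' _ hn'.le, hnδ]; field_simp
      rw [this]
      nlinarith [mul_pos hsn hδ0]
    have h2 : √((d : ℝ) * (2 * (k * δ ^ 2))) = √d * √(2 * k) * δ := by
      rw [show (d : ℝ) * (2 * (k * δ ^ 2)) = d * (2 * k) * δ ^ 2 by ring,
        Real.sqrt_mul (by positivity), Real.sqrt_sq hδ0.le, Real.sqrt_mul (by positivity)]
    have hsd : 0 < √(d : ℝ) := Real.sqrt_pos.2 (by exact_mod_cast hd)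
    have hdd : √(d : ℝ) * √d = d := Real.mul_self_sqrt (by positivity)
    rw [h2] at key
    have h3 : (√d * √d) * (δ / 2) ≤ M * (r * (√d * √(2 * k) * δ)) := by
      rw [hdd]
      refine le_trans ?_ key
      gcongr
      linarith
    refine le_of_mul_le_mul_right (a := √d * δ) ?_ (by positivity)
    nlinarith
  · intro j
    have e := integral_sq_shiftDensity_sub_sum j (fun _ : Fin n => δ) 1 φ
    simp only [one_mul, mul_one, one_pow] at e
    rw [e]
    -- Disjoint blocks give orthogonal terms, so the squared error is the norm of the full term
    -- minus those of the block terms, a quantity of second order in `n δ²`.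
    have hdiag : ∀ l, ∑ l', (Real.exp (∑ i, φ l i * φ l' i) - 1) =
        Real.exp (∑ i, φ l i * φ l i) - 1 := by
      intro l
      refine Finset.sum_eq_single l (fun l' _ hl' => ?_) (by simp)
      rw [Finset.sum_eq_zero, Real.exp_zero, sub_self]
      intro i _
      by_cases hi : blk i = l
      · simp [φ, hi, hl'.symm]
      · simp [φ, hi]
    simp_rw [hdiag, hcard, hcard']
    have hlow : (n : ℝ) * δ ^ 2 ≤ ∑ l : Fin M, (Real.exp
        ((Finset.univ.filter fun i => blk i = l).card * δ ^ 2) - 1) := by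
      calc (n : ℝ) * δ ^ 2
          = ∑ l : Fin M, ((Finset.univ.filter fun i => blk i = l).card : ℝ) * δ ^ 2 := by
            rw [← Finset.sum_mul, ← Nat.cast_sum,
              ← Finset.card_eq_sum_card_fiberwise (fun i _ => Finset.mem_coe.2 (Finset.mem_univ _))]
            simp
        _ ≤ _ := Finset.sum_le_sum fun l _ => by
            linarith [Real.add_one_le_exp
              (((Finset.univ.filter fun i => blk i = l).card : ℝ) * δ ^ 2)]
    have hup := exp_sub_one_sub_id_le_sq hy0 hy1
    have hc : ∑ _i : Fin n, δ * δ = n * δ ^ 2 := by simp [sq]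
    rw [hc]
    linarith
  · intro μ
    have hi : ∀ j l, Integrable (fun x => centered f μ x j * (shiftDensity j (φ l) x - 1))
        (stdLaw n d) := fun j l =>
      (h.memLp_coord hC μ j).integrable_mul (memLp_shiftDensity_sub_one j _)
    simp_rw [Finset.mul_sum]
    simp_rw [integral_finsetSum _ fun l _ => hi _ l]
    rw [Finset.sum_comm]
    refine (Finset.sum_le_card_nsmul _ _ (r * √(d * (2 * (k * δ ^ 2)))) fun l _ => ?_).trans
      (by simp)
    let Z : (Fin n → EuclideanSpace ℝ (Fin d)) → Fin n → EuclideanSpace ℝ (Fin d) :=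
      fun x i => if blk i = l then 0 else x i
    have hZ : Measurable Z := by
      refine measurable_pi_lambda _ fun i => ?_
      by_cases hi : blk i = l
      · simp [Z, hi]
      · simpa [Z, hi] using measurable_pi_apply i
    have hZk : ∀ x, (Finset.univ.filter fun i => x i ≠ Z x i).card ≤ k := by
      intro x
      refine (Finset.card_le_card fun i => ?_).trans (hblk l)
      simp only [Finset.mem_filter, Finset.mem_univ, true_and]
      intro hne
      by_contra hi
      exact hne (by simp [Z, hi])
    obtain ⟨hL, hs⟩ := h.sub_comp_memLp_and_sum_le μ hZ hZk
    have hm := measurable_centered h.measurable μ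
    have hmZ : Measurable fun x => centered f μ (Z x) := hm.comp hZ
    -- `Z x` does not see block `l`, hence is uncorrelated with that block's likelihood ratio;
    -- subtracting it brings in the sensitivity.
    have hzero : ∀ j, ∫ x, centered f μ x j * (shiftDensity j (φ l) x - 1) ∂(stdLaw n d) =
        ∫ x, (centered f μ x j - centered f μ (Z x) j) * (shiftDensity j (φ l) x - 1)
          ∂(stdLaw n d) := by
      intro j
      have hLZ : MemLp (fun x => centered f μ (Z x) j) 2 (stdLaw n d) := by
        have := (h.memLp_coord hC μ j).sub (hL j)
        refine this.congr_norm (Measurable.aestronglyMeasurable (by fun_prop)) (.of_forall fun x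
          => ?_)
        simp
      have e := integral_comp_sampleShift j (φ l) (G := fun x => centered f μ (Z x) j)
        (by fun_prop)
      have hinv : ∀ x, Z (sampleShift j (φ l) x) = Z x := by
        intro x
        ext1 i
        by_cases hi : blk i = l
        · simp [Z, hi]
        · simp [Z, hi, sampleShift, coordShift, φ]
      simp_rw [hinv] at e
      have h0 : ∫ x, centered f μ (Z x) j * (shiftDensity j (φ l) x - 1) ∂(stdLaw n d) = 0 := by
        simp_rw [mul_sub, mul_one]
        have hint : Integrable (fun x => centered f μ (Z x) j * shiftDensity j (φ l) x)
            (stdLaw n d) := hLZ.integrable_mul (memLp_shiftDensity j _)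
        rw [integral_sub hint (hLZ.integrable (by norm_num)), e]
        simp_rw [mul_comm (centered f μ (Z _) j)]
        rw [sub_self]
      have hint : Integrable (fun x => centered f μ (Z x) j * (shiftDensity j (φ l) x - 1))
          (stdLaw n d) := hLZ.integrable_mul (memLp_shiftDensity_sub_one j _)
      simp_rw [sub_mul (centered f μ _ j)]
      rw [integral_sub (hi j l) hint, h0, sub_zero]
    simp_rw [hzero]
    refine (sum_integral_mul_le hL (fun j => memLp_shiftDensity_sub_one j _) hs
      (b := d * (2 * (k * δ ^ 2))) ?_).trans (by rw [Real.sqrt_sq hr])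
    simp_rw [sq (shiftDensity _ _ _ - 1), integral_shiftDensity_sub_one_mul]
    exact (Finset.sum_le_sum fun j _ => hkδ l).trans (by simp)

/-! ### Random sparse translations -/

theorem card_filter_apply_eq {k M : ℕ} (p : Fin k) (b : Fin M) :
    ((Finset.univ.filter fun c : Fin k → Fin M => c p = b).card : ℝ) * M = (M : ℝ) ^ k := by
  have h : (Finset.univ.filter fun c : Fin k → Fin M => c p = b).card = M ^ (k - 1) := by
    rw [Finset.card_filter, ← (Equiv.funSplitAt p (Fin M)).symm.sum_comp, Fintype.sum_prod_type]
    simp [Equiv.funSplitAt, Fintype.card_subtype_compl]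
  rw [h]
  have : 0 < k := p.pos
  push_cast
  rw [← pow_succ, Nat.sub_add_cancel this]

/-- A sample shifted under both `c` and `c'` sits at a position where they agree, and distinct such
samples have distinct positions. The resulting bound factors over the `k` positions. It is only an
inequality because some pairs (block, position) may carry no sample. -/
theorem sum_exp_agreements_le {k M : ℕ} {τ : ℝ} (blk : Fin n → Fin M) (pos : Fin n → Fin k)
    (hinj : Function.Injective fun i => (blk i, pos i)) (c : Fin k → Fin M) :
    ∑ c' : Fin k → Fin M, Real.exp (∑ i, (if c (pos i) = blk i then τ else 0) *
        (if c' (pos i) = blk i then τ else 0)) ≤ (M + (Real.exp (τ ^ 2) - 1)) ^ k := by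
  have hle : ∀ c' : Fin k → Fin M, Real.exp (∑ i, (if c (pos i) = blk i then τ else 0) *
        (if c' (pos i) = blk i then τ else 0)) ≤
      ∏ b, (if c b = c' b then Real.exp (τ ^ 2) else 1) := by
    intro c'
    have e : ∏ b, (if c b = c' b then Real.exp (τ ^ 2) else 1) =
        Real.exp (((Finset.univ.filter fun b => c b = c' b).card : ℝ) * τ ^ 2) := by
      rw [Finset.prod_ite, Finset.prod_const, Finset.prod_const_one, mul_one, ← Real.exp_nat_mul]
    rw [e, Real.exp_le_exp]
    have e2 : ∑ i, (if c (pos i) = blk i then τ else 0) * (if c' (pos i) = blk i then τ else 0) =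
        ((Finset.univ.filter fun i => c (pos i) = blk i ∧ c' (pos i) = blk i).card : ℝ)
          * τ ^ 2 := by
      rw [← nsmul_eq_mul, ← Finset.sum_const, Finset.sum_filter]
      refine Finset.sum_congr rfl fun i _ => ?_
      by_cases h1 : c (pos i) = blk i <;> by_cases h2 : c' (pos i) = blk i <;> simp [h1, h2, sq]
    rw [e2]
    gcongr
    refine Finset.card_le_card_of_injOn pos (fun i hi => ?_) fun i hi i' hi' hpp => ?_
    · simp only [Finset.coe_filter, Finset.mem_univ, true_and, Set.mem_ofPred_eq] at hi ⊢
      rw [hi.1, hi.2]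
    · simp only [Finset.coe_filter, Finset.mem_univ, true_and, Set.mem_ofPred_eq] at hi hi'
      exact hinj (Prod.ext (show blk i = blk i' by rw [← hi.1, ← hi'.1, hpp]) hpp)
  refine (Finset.sum_le_sum fun c' _ => hle c').trans (le_of_eq ?_)
  have hp := Finset.prod_univ_sum (fun _ : Fin k => (Finset.univ : Finset (Fin M)))
    (fun b l => if c b = l then Real.exp (τ ^ 2) else 1)
  rw [Fintype.piFinset_univ] at hp
  rw [← hp]
  have hs : ∀ b : Fin k, ∑ l : Fin M, (if c b = l then Real.exp (τ ^ 2) else 1) =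
      M + (Real.exp (τ ^ 2) - 1) := by
    intro b
    have : ∀ l : Fin M, (if c b = l then Real.exp (τ ^ 2) else 1) =
        1 + (if c b = l then Real.exp (τ ^ 2) - 1 else 0) := by
      intro l; split_ifs <;> ring
    simp_rw [this]
    rw [Finset.sum_add_distrib, Finset.sum_ite_eq]
    simp
  simp_rw [hs]
  simp

/-- For each position `b`, pick a block `c b` uniformly and shift the sample there, if any, by `τ`.
Each sample moves with probability `1 / M`, so the average shift is `δ = τ / M`, yet at most `k`
samples move. The hypothesis `hle` bounds the squared `L²` distance between the likelihood ratio of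
the mixture and that of the translation. -/
theorem translation_le_of_sparse (h : SensitivityBound k C r f) (hC : 0 ≤ C) (hr : 0 ≤ r)
    (hd : 0 < d) {M : ℕ} (hM : 0 < M) (blk : Fin n → Fin M) (pos : Fin n → Fin k)
    (hinj : Function.Injective fun i => (blk i, pos i)) {τ ρ : ℝ} (hρ : 0 ≤ ρ)
    (hle : (Real.exp (n * (τ / M) ^ 2) - 1 - n * (τ / M) ^ 2) +
      (Real.exp (k * (Real.exp (τ ^ 2) - 1) / M) - 1 - n * (τ / M) ^ 2) ≤ ρ ^ 2) :
    τ / M - √(C / n) * ρ ≤ r := by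
  classical
  have hM' : (0 : ℝ) < M := by exact_mod_cast hM
  set δ : ℝ := τ / M with hδ
  let φ : (Fin k → Fin M) → Fin n → ℝ := fun c i => if c (pos i) = blk i then τ else 0
  set w : ℝ := ((M : ℝ) ^ k)⁻¹ with hw
  have hw0 : 0 < w := by positivity
  have hwM : w * (M : ℝ) ^ k = 1 := inv_mul_cancel₀ (by positivity)
  have key := h.le_of_approx hC (δ := δ) (ρ := ρ) (B := d * r)
    hρ (H := fun j x => w * ∑ c, (shiftDensity j (φ c) x - 1))
    (fun j => (memLp_finsetSum _ fun c _ => memLp_shiftDensity_sub_one j _).const_mul w) ?_ ?_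
  · exact le_of_mul_le_mul_left key (by exact_mod_cast hd)
  · intro j
    rw [integral_sq_shiftDensity_sub_sum j (fun _ : Fin n => δ) w φ]
    have hc : ∑ _i : Fin n, δ * δ = n * δ ^ 2 := by simp [sq]
    rw [hc]
    -- The cross term is at least its linearization, by `1 + x ≤ exp x`; the linear part is computed
    -- from the probability `1 / M` of each shift.
    have hlin : (n : ℝ) * δ ^ 2 ≤ w * ∑ c, (Real.exp (∑ i, δ * φ c i) - 1) := by
      have h1 : ∑ c, ∑ i, δ * φ c i = δ * τ * (n * ((M : ℝ) ^ k / M)) := by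
        rw [Finset.sum_comm]
        have : ∀ i, ∑ c, δ * φ c i = δ * τ * ((M : ℝ) ^ k / M) := by
          intro i
          rw [← card_filter_apply_eq (pos i) (blk i), mul_div_cancel_right₀ _ hM'.ne']
          simp [φ, Finset.sum_ite]
          ring
        simp_rw [this]
        simp
        ring
      calc (n : ℝ) * δ ^ 2 = (w * (M : ℝ) ^ k) * (n * δ ^ 2) := by rw [hwM, one_mul]
        _ = w * (δ * τ * (n * ((M : ℝ) ^ k / M))) := by rw [hδ]; ring
        _ = w * ∑ c, ∑ i, δ * φ c i := by rw [h1]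
        _ ≤ _ := by
          gcongr with c
          linarith [Real.add_one_le_exp (∑ i, δ * φ c i)]
    have hquad : w ^ 2 * ∑ a, ∑ b, (Real.exp (∑ i, φ a i * φ b i) - 1) ≤
        Real.exp (k * (Real.exp (τ ^ 2) - 1) / M) - 1 := by
      have hcardM : (Fintype.card (Fin k → Fin M) : ℝ) = (M : ℝ) ^ k := by simp
      have h1 : ∑ a, ∑ b, (Real.exp (∑ i, φ a i * φ b i) - 1) ≤
          (M : ℝ) ^ k * ((M + (Real.exp (τ ^ 2) - 1)) ^ k - (M : ℝ) ^ k) := by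
        rw [← hcardM, ← nsmul_eq_mul]
        refine Finset.sum_le_card_nsmul _ _ _ fun a _ => ?_
        rw [Finset.sum_sub_distrib]
        refine sub_le_sub (sum_exp_agreements_le blk pos hinj a) (le_of_eq ?_)
        simp
      have h2 : w * (M + (Real.exp (τ ^ 2) - 1)) ^ k ≤
          Real.exp (k * (Real.exp (τ ^ 2) - 1) / M) := by
        have ha : 0 ≤ Real.exp (τ ^ 2) - 1 := by
          linarith [Real.add_one_le_exp (τ ^ 2), sq_nonneg τ]
        rw [mul_div_assoc, Real.exp_nat_mul, hw, ← inv_pow, ← mul_pow]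
        refine pow_le_pow_left₀ (by positivity) ?_ k
        have := Real.add_one_le_exp ((Real.exp (τ ^ 2) - 1) / M)
        rw [mul_add, inv_mul_cancel₀ hM'.ne']
        rw [div_eq_inv_mul] at this ⊢
        linarith
      calc _ ≤ w ^ 2 * ((M : ℝ) ^ k * ((M + (Real.exp (τ ^ 2) - 1)) ^ k - (M : ℝ) ^ k)) := by
            gcongr
        _ = (w * (M : ℝ) ^ k) * (w * (M + (Real.exp (τ ^ 2) - 1)) ^ k - w * (M : ℝ) ^ k) := by
            ring
        _ ≤ _ := by rw [hwM]; linarith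
    linarith
  · intro μ
    refine (Finset.sum_le_card_nsmul _ _ r fun j _ => ?_).trans (by simp)
    have hi : ∀ c, Integrable (fun x => centered f μ x j * (shiftDensity j (φ c) x - 1))
        (stdLaw n d) := fun c =>
      (h.memLp_coord hC μ j).integrable_mul (memLp_shiftDensity_sub_one j _)
    have hswap : ∫ x, centered f μ x j * (w * ∑ c, (shiftDensity j (φ c) x - 1)) ∂(stdLaw n d) =
        w * ∑ c, ∫ x, centered f μ x j * (shiftDensity j (φ c) x - 1) ∂(stdLaw n d) := by
      rw [← integral_finsetSum _ fun c _ => hi c, ← integral_const_mul]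
      congr 1
      ext x
      rw [mul_left_comm, Finset.mul_sum]
    rw [hswap]
    -- The change of variables turns the correlation into the mean change of `f` when the selected
    -- samples are moved.
    have hc : ∀ c, ∫ x, centered f μ x j * (shiftDensity j (φ c) x - 1) ∂(stdLaw n d) ≤ r := by
      intro c
      have hTk : ∀ x, (Finset.univ.filter fun i => x i ≠ sampleShift j (φ c) x i).card ≤ k := by
        intro x
        have hsub : (Finset.univ.filter fun i => x i ≠ sampleShift j (φ c) x i) ⊆
            Finset.univ.filter fun i => c (pos i) = blk i := by
          intro i
          simp only [Finset.mem_filter, Finset.mem_univ, true_and]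
          intro hne
          by_contra hi
          exact hne (by simp [sampleShift, coordShift, φ, hi])
        refine (Finset.card_le_card hsub).trans ?_
        refine (Finset.card_le_card_of_injOn pos (t := Finset.univ) (fun i _ => by simp)
          fun i hi i' hi' hpp => ?_).trans (by simp)
        simp only [Finset.coe_filter, Finset.mem_univ, true_and, Set.mem_ofPred_eq] at hi hi'
        exact hinj (Prod.ext (show blk i = blk i' by rw [← hi, ← hi', hpp]) hpp)
      obtain ⟨hL, hs⟩ := h.sub_comp_memLp_and_sum_le μ (measurable_sampleShift j (φ c)) hTk
      have hm := measurable_centered h.measurable μ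
      have e := integral_comp_sampleShift j (φ c) (G := fun x => centered f μ x j) (by fun_prop)
      have hF := (h.memLp_coord hC μ j).integrable (by norm_num : (1 : ℝ≥0∞) ≤ 2)
      have hD := (hL j).integrable (by norm_num : (1 : ℝ≥0∞) ≤ 2)
      have hG : Integrable (fun x => centered f μ (sampleShift j (φ c) x) j) (stdLaw n d) := by
        refine (hF.sub hD).congr (.of_forall fun x => ?_)
        simp
      have e2 : ∫ x, centered f μ x j * (shiftDensity j (φ c) x - 1) ∂(stdLaw n d) =
          ∫ x, (centered f μ x j - centered f μ (sampleShift j (φ c) x) j) * (-1)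
            ∂(stdLaw n d) := by
        simp_rw [mul_sub, mul_one, mul_neg, mul_one, neg_sub]
        have hint : Integrable (fun x => centered f μ x j * shiftDensity j (φ c) x)
            (stdLaw n d) := (h.memLp_coord hC μ j).integrable_mul (memLp_shiftDensity j _)
        rw [integral_sub hint hF,
          integral_sub hG hF, e]
        simp_rw [mul_comm (centered f μ _ j)]
      rw [e2]
      refine (integral_mul_le_sqrt_mul_sqrt (hL j) (memLp_const (-1 : ℝ))).trans ?_
      have hsj : ∫ x, (centered f μ x j - centered f μ (sampleShift j (φ c) x) j) ^ 2
          ∂(stdLaw n d) ≤ r ^ 2 :=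
        (Finset.single_le_sum (f := fun j' => ∫ x, (centered f μ x j' -
            centered f μ (sampleShift j (φ c) x) j') ^ 2 ∂(stdLaw n d))
          (fun _ _ => integral_nonneg fun _ => sq_nonneg _) (Finset.mem_univ j)).trans hs
      have := Real.sqrt_le_sqrt hsj
      rw [Real.sqrt_sq hr] at this
      simpa using this
    calc _ ≤ w * ∑ _c : Fin k → Fin M, r := by gcongr with c; exact hc c
      _ = (w * (M : ℝ) ^ k) * r := by simp; ring
      _ = r := by rw [hwM, one_mul]

end SensitivityBound

/-! ### Couplings -/

/-- The maximal coupling of a probability measure with an absolutely continuous one. -/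
theorem exists_coupling_withDensity {X : Type*} [MeasurableSpace X]
    (hdiag : MeasurableSet {z : X × X | z.1 = z.2}) (P : Measure X) [IsProbabilityMeasure P]
    {q : X → ℝ≥0∞} (hq : Measurable q) (hq1 : ∫⁻ x, q x ∂P = 1) :
    ∃ π : Measure (X × X), π.map Prod.fst = P ∧ π.map Prod.snd = P.withDensity q ∧
      π {z | z.1 ≠ z.2} ≤ ∫⁻ x, (1 - q x) ∂P := by
  set κ := P.withDensity (fun x => min 1 (q x)) with hκ
  set α := P.withDensity (fun x => 1 - q x) with hα
  set β := P.withDensity (fun x => q x - 1) with hβ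
  set t := ∫⁻ x, (1 - q x) ∂P with ht
  have hαm : Measurable fun x => 1 - q x := measurable_const.sub hq
  have hβm : Measurable fun x => q x - 1 := hq.sub measurable_const
  have hκm : Measurable fun x => min 1 (q x) := measurable_const.min hq
  have hκα : κ + α = P := by
    rw [hκ, hα, ← withDensity_add_left hκm]
    have : ((fun x => min 1 (q x)) + fun x => 1 - q x) = (1 : X → ℝ≥0∞) := by
      ext x
      rcases le_total 1 (q x) with h | h <;> simp [h, tsub_eq_zero_of_le]
    rw [this, withDensity_one]
  have hκβ : κ + β = P.withDensity q := by
    rw [hκ, hβ, ← withDensity_add_left hκm]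
    congr 1
    ext x
    rcases le_total 1 (q x) with h | h <;> simp [h, tsub_eq_zero_of_le]
  have htα : α Set.univ = t := by simp [hα, ht]
  have hκfin : κ Set.univ ≠ ∞ := by
    refine ne_top_of_le_ne_top ENNReal.one_ne_top ?_
    calc κ Set.univ ≤ (κ + α) Set.univ := by simp
      _ = 1 := by rw [hκα]; simp
  have htβ : β Set.univ = t := by
    have h1 : κ Set.univ + α Set.univ = 1 := by
      rw [← Measure.add_apply, hκα]; simp
    have h2 : κ Set.univ + β Set.univ = 1 := by
      rw [← Measure.add_apply, hκβ]; simp [hq1]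
    rw [← htα]
    exact (ENNReal.add_right_inj hκfin).1 (h2.trans h1.symm)
  have htop : t ≠ ∞ := by
    refine ne_top_of_le_ne_top ENNReal.one_ne_top ?_
    calc t = α Set.univ := htα.symm
      _ ≤ (κ + α) Set.univ := by simp
      _ = 1 := by rw [hκα]; simp
  have : IsFiniteMeasure α := ⟨by rw [htα]; exact htop.lt_top⟩
  have : IsFiniteMeasure β := ⟨by rw [htβ]; exact htop.lt_top⟩
  have hscale : ∀ ν : Measure X, ν Set.univ = t → t⁻¹ • t • ν = ν := by
    intro ν hν
    rcases eq_or_ne t 0 with h0 | h0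
    · rw [h0] at hν
      rw [Measure.measure_univ_eq_zero.1 hν]
      simp
    · rw [smul_smul, ENNReal.inv_mul_cancel h0 htop, one_smul]
  -- The common mass stays on the diagonal and the excesses are coupled independently. If `t = 0`
  -- both excesses vanish, so the infinite factor `t⁻¹` is harmless.
  refine ⟨κ.map (fun x => (x, x)) + t⁻¹ • (α.prod β), ?_, ?_, ?_⟩
  · rw [Measure.map_add _ _ measurable_fst, Measure.map_smul,
      Measure.map_map measurable_fst (by fun_prop), Measure.map_fst_prod, htβ, hscale α htα]
    simpa [Function.comp_def] using hκα
  · rw [Measure.map_add _ _ measurable_snd, Measure.map_smul,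
      Measure.map_map measurable_snd (by fun_prop), Measure.map_snd_prod, htα, hscale β htβ]
    simpa [Function.comp_def] using hκβ
  · have h1 : κ.map (fun x => (x, x)) {z : X × X | z.1 ≠ z.2} = 0 := by
      have hne : MeasurableSet {z : X × X | z.1 ≠ z.2} := hdiag.compl
      rw [Measure.map_apply (by fun_prop) hne]
      simp
    rw [Measure.add_apply, h1, zero_add, Measure.smul_apply, smul_eq_mul]
    calc t⁻¹ * (α.prod β) {z | z.1 ≠ z.2} ≤ t⁻¹ * (α.prod β) Set.univ := by
          gcongr; exact Set.subset_univ _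
      _ = t⁻¹ * (t * t) := by
          rw [← Set.univ_prod_univ, Measure.prod_prod, htα, htβ]
      _ ≤ t := by
          rcases eq_or_ne t 0 with h0 | h0
          · simp [h0]
          · rw [← mul_assoc, ENNReal.inv_mul_cancel h0 htop, one_mul]

/-- A function of a pair that is dominated by a function of the first component integrates to at
most the integral of the latter, even if the latter is not measurable. -/
theorem lintegral_le_of_le_fst {X Y : Type*} [MeasurableSpace X] [MeasurableSpace Y]
    [StandardBorelSpace Y] [Nonempty Y] (ρ : Measure (X × Y)) [IsFiniteMeasure ρ]
    {G : X × Y → ℝ≥0∞} (hG : Measurable G) {g : X → ℝ≥0∞} (h : ∀ z, G z ≤ g z.1) :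
    ∫⁻ z, G z ∂ρ ≤ ∫⁻ x, g x ∂(ρ.map Prod.fst) := by
  conv_lhs => rw [← ρ.disintegrate ρ.condKernel]
  rw [Measure.lintegral_compProd hG]
  refine lintegral_mono fun x => ?_
  calc ∫⁻ y, G (x, y) ∂(ρ.condKernel x) ≤ ∫⁻ _, g x ∂(ρ.condKernel x) :=
        lintegral_mono fun y => h (x, y)
    _ = g x := by simp

/-- Total variation is bounded by the `L¹` and then the `L²` norm of the centered likelihood ratio.
-/
theorem exists_coupling_coordShift (j : Fin d) (δ : ℝ) :
    ∃ π : Measure (EuclideanSpace ℝ (Fin d) × EuclideanSpace ℝ (Fin d)),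
      π.map Prod.fst = stdGaussian _ ∧ π.map Prod.snd = (stdGaussian _).map (coordShift j δ) ∧
      π {z | z.1 ≠ z.2} ≤ ENNReal.ofReal √(Real.exp (δ ^ 2) - 1) := by
  set q : EuclideanSpace ℝ (Fin d) → ℝ := fun x => Real.exp (δ * x j - δ ^ 2 / 2) with hqdef
  have hq : Measurable q := by fun_prop
  have hmap : (stdGaussian _).map (coordShift j δ) =
      (stdGaussian _).withDensity fun x => ENNReal.ofReal (q x) := stdGaussian_map_coordShift j δ
  have hq1 : ∫⁻ x, ENNReal.ofReal (q x) ∂(stdGaussian (EuclideanSpace ℝ (Fin d))) = 1 := by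
    have e := congrArg (fun m => m Set.univ) hmap
    simp only [withDensity_apply _ MeasurableSet.univ, Measure.restrict_univ] at e
    rw [← e, Measure.map_apply (measurable_coordShift j δ) MeasurableSet.univ]
    simp
  obtain ⟨π, h1, h2, h3⟩ := exists_coupling_withDensity
    (measurableSet_eq_fun measurable_fst measurable_snd) (stdGaussian (EuclideanSpace ℝ (Fin d)))
    hq.ennreal_ofReal hq1
  refine ⟨π, h1, h2.trans hmap.symm, h3.trans ?_⟩
  -- Viewing a vector as a one-sample dataset makes the `L²` formula for `shiftDensity` available.
  have hs : ∀ x : Fin 1 → EuclideanSpace ℝ (Fin d), q (x 0) = shiftDensity j (fun _ => δ) x := by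
    intro x
    simp [q, shiftDensity]
  have hL := memLp_shiftDensity_sub_one j (fun _ : Fin 1 => δ)
  calc ∫⁻ x, (1 - ENNReal.ofReal (q x)) ∂(stdGaussian (EuclideanSpace ℝ (Fin d)))
      = ∫⁻ x, (1 - ENNReal.ofReal (q (x 0))) ∂(stdLaw 1 d) :=
        ((measurePreserving_eval (fun _ : Fin 1 => stdGaussian (EuclideanSpace ℝ (Fin d)))
          0).lintegral_comp (measurable_const.sub hq.ennreal_ofReal)).symm
    _ ≤ ∫⁻ x, ENNReal.ofReal |shiftDensity j (fun _ => δ) x - 1| ∂(stdLaw 1 d) := by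
        refine lintegral_mono fun x => ?_
        rw [hs, ← ENNReal.ofReal_one, ← ENNReal.ofReal_sub _ (shiftDensity_pos j _ x).le,
          abs_sub_comm]
        exact ENNReal.ofReal_le_ofReal (le_abs_self _)
    _ = ENNReal.ofReal (∫ x, |shiftDensity j (fun _ => δ) x - 1| ∂(stdLaw 1 d)) :=
        (ofReal_integral_eq_lintegral_ofReal (hL.integrable (by norm_num)).abs
          (.of_forall fun x => abs_nonneg _)).symm
    _ ≤ ENNReal.ofReal √(Real.exp (δ ^ 2) - 1) := by
        refine ENNReal.ofReal_le_ofReal ?_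
        have := integral_mul_le_sqrt_mul_sqrt hL.abs (memLp_const (1 : ℝ))
        simp only [Pi.abs_apply, mul_one, sq_abs, one_pow, integral_const, probReal_univ,
          smul_eq_mul, Real.sqrt_one] at this
        refine this.trans (le_of_eq ?_)
        simp_rw [sq (shiftDensity _ _ _ - 1), integral_shiftDensity_sub_one_mul]
        simp [sq]

open Classical in
-- Couple the samples independently; the expected number of disagreements is at most `n` times the
-- one-sample bound, and Markov's inequality does the rest.
theorem exists_coupling_sampleShift (j : Fin d) (δ : ℝ) :
    ∃ ρ : Measure ((Fin n → EuclideanSpace ℝ (Fin d)) × (Fin n → EuclideanSpace ℝ (Fin d))),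
      ρ.map Prod.fst = stdLaw n d ∧
      ρ.map Prod.snd = (stdLaw n d).map (sampleShift j fun _ => δ) ∧
      ∀ k : ℕ, 0 < k →
        MeasurableSet {z : (Fin n → EuclideanSpace ℝ (Fin d)) × (Fin n → EuclideanSpace ℝ (Fin d))
          | k ≤ (Finset.univ.filter fun i => z.1 i ≠ z.2 i).card} ∧
        ρ.real {z | k ≤ (Finset.univ.filter fun i => z.1 i ≠ z.2 i).card} ≤
          n * √(Real.exp (δ ^ 2) - 1) / k := by
  obtain ⟨π, h1, h2, h3⟩ := exists_coupling_coordShift j δ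
  have hπ : IsProbabilityMeasure π := by
    refine ⟨?_⟩
    rw [← Set.preimage_univ (f := Prod.fst), ← Measure.map_apply measurable_fst .univ, h1]
    simp
  let sp : (Fin n → EuclideanSpace ℝ (Fin d) × EuclideanSpace ℝ (Fin d)) →
      (Fin n → EuclideanSpace ℝ (Fin d)) × (Fin n → EuclideanSpace ℝ (Fin d)) :=
    fun z => (fun i => (z i).1, fun i => (z i).2)
  have hsp : Measurable sp := by fun_prop
  have hp1 : IsProbabilityMeasure (π.map Prod.fst) :=
    Measure.isProbabilityMeasure_map measurable_fst.aemeasurable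
  have hp2 : IsProbabilityMeasure (π.map Prod.snd) :=
    Measure.isProbabilityMeasure_map measurable_snd.aemeasurable
  have hp3 : IsProbabilityMeasure
      ((stdGaussian (EuclideanSpace ℝ (Fin d))).map (coordShift j δ)) :=
    Measure.isProbabilityMeasure_map (measurable_coordShift j δ).aemeasurable
  refine ⟨(Measure.pi fun _ : Fin n => π).map sp, ?_, ?_, ?_⟩
  · rw [Measure.map_map measurable_fst hsp]
    have := Measure.pi_map_pi (μ := fun _ : Fin n => π) (f := fun _ => Prod.fst)
      (fun _ => measurable_fst.aemeasurable)
    simp_rw [h1] at this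
    exact this
  · rw [Measure.map_map measurable_snd hsp]
    have e1 := Measure.pi_map_pi (μ := fun _ : Fin n => π) (f := fun _ => Prod.snd)
      (fun _ => measurable_snd.aemeasurable)
    have e2 := Measure.pi_map_pi (μ := fun _ : Fin n => stdGaussian (EuclideanSpace ℝ (Fin d)))
      (f := fun _ => coordShift j δ) (fun _ => (measurable_coordShift j δ).aemeasurable)
    simp_rw [h2] at e1
    exact e1.trans e2.symm
  · intro k hk
    have hne : MeasurableSet
        {z : EuclideanSpace ℝ (Fin d) × EuclideanSpace ℝ (Fin d) | z.1 ≠ z.2} :=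
      (measurableSet_eq_fun measurable_fst measurable_snd).compl
    have hnei : ∀ i : Fin n, MeasurableSet
        {z : (Fin n → EuclideanSpace ℝ (Fin d)) × (Fin n → EuclideanSpace ℝ (Fin d)) |
          z.1 i ≠ z.2 i} := fun i =>
      (measurableSet_eq_fun (by fun_prop) (by fun_prop)).compl
    let N : (Fin n → EuclideanSpace ℝ (Fin d)) × (Fin n → EuclideanSpace ℝ (Fin d)) → ℝ≥0∞ :=
      fun z => ∑ i, {z | z.1 i ≠ z.2 i}.indicator 1 z
    have hN : Measurable N :=
      Finset.measurable_sum _ fun i _ => measurable_one.indicator (hnei i)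
    have hNe : ∀ z, N z = ((Finset.univ.filter fun i => z.1 i ≠ z.2 i).card : ℕ) := by
      intro z
      simp [N, Set.indicator_apply, Finset.sum_ite]
    have hset : {z : (Fin n → EuclideanSpace ℝ (Fin d)) × (Fin n → EuclideanSpace ℝ (Fin d)) |
        k ≤ (Finset.univ.filter fun i => z.1 i ≠ z.2 i).card} = {z | (k : ℝ≥0∞) ≤ N z} := by
      ext z
      simp [hNe]
    rw [hset]
    refine ⟨measurableSet_le measurable_const hN, ?_⟩
    refine ENNReal.toReal_le_of_le_ofReal (by positivity) ?_
    have hint : ∫⁻ z, N z ∂((Measure.pi fun _ : Fin n => π).map sp) ≤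
        ENNReal.ofReal (n * √(Real.exp (δ ^ 2) - 1)) := by
      rw [lintegral_finsetSum _ fun i _ => measurable_one.indicator (hnei i)]
      refine (Finset.sum_le_card_nsmul _ _ (ENNReal.ofReal √(Real.exp (δ ^ 2) - 1))
        fun i _ => ?_).trans (le_of_eq ?_)
      · rw [lintegral_indicator_one (hnei i), Measure.map_apply hsp (hnei i)]
        refine le_trans (le_of_eq ?_) h3
        exact (measurePreserving_eval (fun _ : Fin n => π) i).measure_preimage hne.nullMeasurableSet
      · rw [ENNReal.ofReal_mul (by positivity)]
        simp
    refine (meas_ge_le_lintegral_div hN.aemeasurable (by exact_mod_cast hk.ne') (by simp)).trans ?_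
    rw [ENNReal.ofReal_div_of_pos (by exact_mod_cast hk)]
    simp only [ENNReal.ofReal_natCast]
    gcongr

/-! ### Sensitivity bound from a coupling -/

namespace SensitivityBound

variable {k : ℕ} {C r : ℝ}
  {f : (Fin n → EuclideanSpace ℝ (Fin d)) → EuclideanSpace ℝ (Fin d)}

/-- When at most `k` samples differ, the two outputs are `r`-close in mean square. On the remaining
event, of probability at most `p`, Cauchy–Schwarz bounds the errors by `√p` times their root mean
squares at `μ` and at `μ + δ e_j`. -/
theorem translation_le_of_coupling (h : SensitivityBound k C r f) (hC : 0 ≤ C) (hr : 0 ≤ r)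
    (hd : 0 < d) {δ p : ℝ} (hδ : 0 ≤ δ)
    (hkp : n * √(Real.exp (δ ^ 2) - 1) / (k + 1 : ℕ) ≤ p) :
    δ * (1 - p) - 2 * √(C / n) * √p ≤ r := by
  classical
  let b : Fin d → EuclideanSpace ℝ (Fin d) → ℝ := fun j μ => ∫ x, centered f μ x j ∂(stdLaw n d)
  let v : Fin d → EuclideanSpace ℝ (Fin d) → ℝ :=
    fun j μ => √(∫ x, centered f μ x j ^ 2 ∂(stdLaw n d))
  have hv0 : ∀ j μ, 0 ≤ v j μ := fun _ _ => Real.sqrt_nonneg _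
  have hvle : ∀ j μ, v j μ ≤ √(C * (d / n)) := fun j μ =>
    Real.sqrt_le_sqrt (h.integral_sq_le hC μ j)
  have hvsum : ∀ μ, ∑ j, v j μ ≤ d * √(C / n) := by
    intro μ
    have h1 := Real.sum_sqrt_mul_sqrt_le (Finset.univ : Finset (Fin d))
      (f := fun j => ∫ x, centered f μ x j ^ 2 ∂(stdLaw n d)) (g := fun _ => 1)
      (fun j => integral_nonneg fun x => sq_nonneg _) (fun _ => zero_le_one)
    simp only [Real.sqrt_one, mul_one, Finset.sum_const, Finset.card_univ, Fintype.card_fin,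
      nsmul_eq_mul] at h1
    refine h1.trans ?_
    calc _ ≤ √(C * (d / n)) * √d := by gcongr; exact h.sum_integral_sq_le hC μ
      _ = d * √(C / n) := by
        rw [← Real.sqrt_mul (by positivity), show C * (d / n) * d = (d : ℝ) ^ 2 * (C / n) by ring,
          Real.sqrt_mul (by positivity), Real.sqrt_sq (by positivity)]
  have step : ∀ j μ, δ * (1 - p) + (b j (μ + EuclideanSpace.single j δ) - b j μ)
      - √p * (v j (μ + EuclideanSpace.single j δ) + v j μ) ≤ r := by
    intro j μ
    obtain ⟨ρ, hρ1, hρ2, hρ3⟩ := exists_coupling_sampleShift (n := n) j δ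
    obtain ⟨hbadm, hbad⟩ := hρ3 (k + 1) k.succ_pos
    replace hbad := hbad.trans hkp
    set bad := {z : (Fin n → EuclideanSpace ℝ (Fin d)) × (Fin n → EuclideanSpace ℝ (Fin d)) |
      k + 1 ≤ (Finset.univ.filter fun i => z.1 i ≠ z.2 i).card} with hbaddef
    have hρP : IsProbabilityMeasure ρ := by
      refine ⟨?_⟩
      rw [← Set.preimage_univ (f := Prod.fst), ← Measure.map_apply measurable_fst .univ, hρ1]
      simp
    have hm := measurable_centered h.measurable μ
    have hm1 : Measurable fun z : (Fin n → EuclideanSpace ℝ (Fin d)) ×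
        (Fin n → EuclideanSpace ℝ (Fin d)) => centered f μ z.1 := hm.comp measurable_fst
    have hm2 : Measurable fun z : (Fin n → EuclideanSpace ℝ (Fin d)) ×
        (Fin n → EuclideanSpace ℝ (Fin d)) => centered f μ z.2 := hm.comp measurable_snd
    have hsh := measurable_sampleShift (n := n) j fun _ => δ
    have fst_int : ∀ G : (Fin n → EuclideanSpace ℝ (Fin d)) → ℝ, Measurable G →
        ∫ z, G z.1 ∂ρ = ∫ x, G x ∂(stdLaw n d) := by
      intro G hG
      rw [← hρ1, integral_map measurable_fst.aemeasurable hG.aestronglyMeasurable]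
    have snd_int : ∀ G : (Fin n → EuclideanSpace ℝ (Fin d)) → ℝ, Measurable G →
        ∫ z, G z.2 ∂ρ = ∫ x, G (sampleShift j (fun _ => δ) x) ∂(stdLaw n d) := by
      intro G hG
      rw [← integral_map hsh.aemeasurable hG.aestronglyMeasurable, ← hρ2,
        integral_map measurable_snd.aemeasurable hG.aestronglyMeasurable]
    have hcs : ∀ x, centered f μ (sampleShift j (fun _ => δ) x) j - δ =
        centered f (μ + EuclideanSpace.single j δ) x j := by
      intro x
      simp [centered_sampleShift]
    have u1 : MemLp (fun z => centered f μ z.1 j) 2 ρ := by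
      have := h.memLp_coord hC μ j
      rw [← hρ1] at this
      exact this.comp_of_map measurable_fst.aemeasurable
    have u2 : MemLp (fun z => centered f μ z.2 j - δ) 2 ρ := by
      have h0 : MemLp (fun x => centered f μ x j - δ) 2 (ρ.map Prod.snd) := by
        rw [hρ2, memLp_map_measure_iff (Measurable.aestronglyMeasurable (by fun_prop))
          hsh.aemeasurable]
        refine (h.memLp_coord hC (μ + EuclideanSpace.single j δ) j).congr_norm
          (Measurable.aestronglyMeasurable ?_) (.of_forall fun x => ?_)
        · exact (Measurable.sub_const (by fun_prop) δ).comp hsh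
        · simp [← hcs]
      exact h0.comp_of_map measurable_snd.aemeasurable
    have e1 : ∫ z, centered f μ z.1 j ∂ρ = b j μ :=
      fst_int (fun x => centered f μ x j) (by fun_prop)
    have e2 : ∫ z, (centered f μ z.2 j - δ) ∂ρ = b j (μ + EuclideanSpace.single j δ) := by
      rw [snd_int (fun x => centered f μ x j - δ) (by fun_prop)]
      simp_rw [hcs]
      rfl
    have s1 : √(∫ z, centered f μ z.1 j ^ 2 ∂ρ) = v j μ := by
      rw [fst_int (fun x => centered f μ x j ^ 2) (by fun_prop)]
    have s2 : √(∫ z, (centered f μ z.2 j - δ) ^ 2 ∂ρ) =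
        v j (μ + EuclideanSpace.single j δ) := by
      rw [snd_int (fun x => (centered f μ x j - δ) ^ 2) (by fun_prop)]
      simp_rw [hcs]
      rfl
    let ind : (Fin n → EuclideanSpace ℝ (Fin d)) × (Fin n → EuclideanSpace ℝ (Fin d)) → ℝ :=
      bad.indicator fun _ => 1
    have hindL : MemLp ind 2 ρ := (memLp_const (1 : ℝ)).indicator hbadm
    have hindi : ∫ z, ind z ∂ρ = ρ.real bad := by
      simp only [ind]
      rw [integral_indicator hbadm]
      simp
    have hinds : √(∫ z, ind z ^ 2 ∂ρ) ≤ √p := by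
      have : ∀ z, ind z ^ 2 = ind z := by
        intro z
        by_cases hz : z ∈ bad <;> simp [ind, hz]
      simp_rw [this, hindi]
      exact Real.sqrt_le_sqrt hbad
    have b1 : -(√p * v j μ) ≤ ∫ z, centered f μ z.1 j * ind z ∂ρ := by
      have := integral_mul_le_sqrt_mul_sqrt u1.neg hindL
      simp only [Pi.neg_apply, neg_mul, integral_neg, neg_sq, s1] at this
      have h2 : v j μ * √(∫ z, ind z ^ 2 ∂ρ) ≤ √p * v j μ := by
        rw [mul_comm]; exact mul_le_mul_of_nonneg_right hinds (hv0 _ _)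
      linarith
    have b2 : ∫ z, (centered f μ z.2 j - δ) * ind z ∂ρ ≤
        √p * v j (μ + EuclideanSpace.single j δ) := by
      have := integral_mul_le_sqrt_mul_sqrt u2 hindL
      rw [s2] at this
      refine this.trans ?_
      rw [mul_comm]; exact mul_le_mul_of_nonneg_right hinds (hv0 _ _)
    let D : (Fin n → EuclideanSpace ℝ (Fin d)) × (Fin n → EuclideanSpace ℝ (Fin d)) →
        EuclideanSpace ℝ (Fin d) := badᶜ.indicator fun z => centered f μ z.2 - centered f μ z.1
    have hDm : Measurable D := (hm2.sub hm1).indicator hbadm.compl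
    have hDr : ∫⁻ z, ‖D z‖ₑ ^ 2 ∂ρ ≤ ENNReal.ofReal (r ^ 2) := by
      obtain ⟨S, hS, hSr⟩ := h.sensitive μ
      rw [← hρ1] at hSr
      -- `S` need not be measurable, so its integral cannot simply be pulled back along the first
      -- projection.
      refine (lintegral_le_of_le_fst ρ (by fun_prop) fun z => ?_).trans hSr
      refine pow_le_pow_left' ?_ 2
      by_cases hz : z ∈ bad
      · simp [D, hz]
      · simp only [D, Set.indicator_of_mem (Set.mem_compl hz)]
        rw [enorm_sub_rev]
        refine hS z.1 z.2 ?_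
        simp only [hbaddef, Set.mem_ofPred_eq] at hz
        omega
    obtain ⟨hDL, hDs⟩ := coord_memLp_and_sum_le hDm (sq_nonneg r) hDr
    have hDj : ∫ z, D z j ∂ρ ≤ r := by
      have := integral_mul_le_sqrt_mul_sqrt (hDL j) (memLp_const (1 : ℝ))
      simp only [mul_one, one_pow, integral_const, probReal_univ, smul_eq_mul,
        Real.sqrt_one] at this
      refine this.trans ?_
      rw [← Real.sqrt_sq hr]
      exact Real.sqrt_le_sqrt ((Finset.single_le_sum (f := fun j => ∫ z, D z j ^ 2 ∂ρ)
        (fun _ _ => integral_nonneg fun _ => sq_nonneg _) (Finset.mem_univ j)).trans hDs)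
    have hDe : ∀ z, D z j = ((centered f μ z.2 j - δ) - centered f μ z.1 j + δ)
        - ((centered f μ z.2 j - δ) * ind z - centered f μ z.1 j * ind z + δ * ind z) := by
      intro z
      by_cases hz : z ∈ bad
      · simp [D, ind, hz]
      · simp only [D, ind, Set.indicator_of_mem (Set.mem_compl hz), Set.indicator_of_notMem hz,
          PiLp.sub_apply]
        ring
    have i1 := u1.integrable (by norm_num : (1 : ℝ≥0∞) ≤ 2)
    have i2 := u2.integrable (by norm_num : (1 : ℝ≥0∞) ≤ 2)
    have i3 : Integrable (fun z => (centered f μ z.2 j - δ) * ind z) ρ := u2.integrable_mul hindL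
    have i4 : Integrable (fun z => centered f μ z.1 j * ind z) ρ := u1.integrable_mul hindL
    have i5 : Integrable (fun z => δ * ind z) ρ :=
      (hindL.integrable (by norm_num : (1 : ℝ≥0∞) ≤ 2)).const_mul δ
    have i6 : Integrable (fun z => (centered f μ z.2 j - δ) - centered f μ z.1 j) ρ := i2.sub i1
    have i7 : Integrable (fun z => (centered f μ z.2 j - δ) * ind z - centered f μ z.1 j * ind z)
      ρ := i3.sub i4
    have i8 : Integrable (fun z => (centered f μ z.2 j - δ) - centered f μ z.1 j + δ) ρ :=
      i6.add (integrable_const δ)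
    have i9 : Integrable (fun z => (centered f μ z.2 j - δ) * ind z - centered f μ z.1 j * ind z
      + δ * ind z) ρ := i7.add i5
    simp_rw [hDe] at hDj
    rw [integral_sub i8 i9, integral_add i6 (integrable_const δ), integral_sub i2 i1,
      integral_add i7 i5, integral_sub i3 i4, integral_const_mul, hindi, e1, e2, integral_const,
      probReal_univ, one_smul] at hDj
    have hδb : δ * ρ.real bad ≤ δ * p := mul_le_mul_of_nonneg_left hbad hδ
    linarith
  -- Adding `√p * v` to the field trades `v` at the shifted means, which differ with `j`, for `v` at
  -- `μ`, where accuracy bounds the sum over `j`.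
  have key := nonpos_of_le_sum_differences δ (√(C * (d / n)) + √p * √(C * (d / n)))
    (d * (δ * (1 - p) - 2 * √(C / n) * √p - r))
    (fun j μ => -b j μ + √p * v j μ) ?_ ?_
  · have hd' : (0 : ℝ) < d := by exact_mod_cast hd
    have := nonpos_of_mul_nonpos_right key hd'
    linarith
  · intro j μ
    refine (abs_add_le _ _).trans (add_le_add ?_ ?_)
    · rw [abs_neg]; exact h.abs_integral_le hC μ j
    · rw [abs_of_nonneg (mul_nonneg (Real.sqrt_nonneg _) (hv0 _ _))]
      exact mul_le_mul_of_nonneg_left (hvle j μ) (Real.sqrt_nonneg _)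
  · intro μ
    have h1 : ∀ j, δ * (1 - p) - r - 2 * √p * v j μ ≤
        -b j (μ + EuclideanSpace.single j δ) + √p * v j (μ + EuclideanSpace.single j δ)
          - (-b j μ + √p * v j μ) := by
      intro j
      linarith [step j μ]
    refine le_trans ?_ (Finset.sum_le_sum fun j _ => h1 j)
    rw [Finset.sum_sub_distrib, ← Finset.mul_sum]
    simp only [Finset.sum_const, Finset.card_univ, Fintype.card_fin, nsmul_eq_mul]
    have h2 := mul_le_mul_of_nonneg_left (hvsum μ) (by positivity : 0 ≤ 2 * √p)
    linarith

end SensitivityBound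

/-! ### Blocks of consecutive samples -/

/-- Euclidean division by `k`. With `M = n / k + 1` blocks, `n ≤ k M ≤ n + k` even when `k` divides
`n`. -/
theorem exists_block_decomposition {k : ℕ} (hk : 0 < k) :
    ∃ (blk : Fin n → Fin (n / k + 1)) (pos : Fin n → Fin k),
      Function.Injective fun i => (blk i, pos i) := by
  refine ⟨fun i => ⟨i / k, Nat.lt_succ_of_le (Nat.div_le_div_right i.2.le)⟩,
    fun i => ⟨i % k, Nat.mod_lt _ hk⟩, fun i i' h => ?_⟩
  simp only [Prod.mk.injEq, Fin.mk.injEq] at h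
  ext
  rw [← Nat.div_add_mod (i : ℕ) k, ← Nat.div_add_mod (i' : ℕ) k, h.1, h.2]

/-! ### The error of a sparse translation -/

/-- With `y = n (τ/M)²`, both exponents equal `y` to leading order because `k M` is close to `n`.
The error is at most `y (κ + 2 τ² + 17 y)` with `κ = k / n`; here `κ` is small since `n` is large,
and `y ≤ 1024 C τ²` is small since `τ` is. -/
theorem sparse_translation_error_le {C n k M τ : ℝ} (hC : 0 < C) (hn : 0 < n) (hk : 0 < k)
    (hM0 : 0 < M) (hkn : k ≤ n) (hkM1 : k * M ≤ n + k) (hkM2 : n ≤ k * M)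
    (hsmall : k ^ 2 ≤ 1024 * C * n) (hnC : 65536 * C ^ 3 ≤ n) (hτ0 : 0 < τ) (hτ1 : τ ^ 2 ≤ 1)
    (hτ2 : 4096 * C * τ ^ 2 ≤ 1) (hτ3 : τ ^ 2 * (2 + 17408 * C) ≤ 1 / (8 * C)) :
    (Real.exp (n * (τ / M) ^ 2) - 1 - n * (τ / M) ^ 2) +
      (Real.exp (k * (Real.exp (τ ^ 2) - 1) / M) - 1 - n * (τ / M) ^ 2) ≤
      n * (τ / M) ^ 2 * (1 / (4 * C)) := by
  have hy0 : 0 < n * (τ / M) ^ 2 := by positivity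
  have hye : n * (τ / M) ^ 2 * M ^ 2 = n * τ ^ 2 := by field_simp
  have ht0 : 0 < τ ^ 2 := by positivity
  generalize n * (τ / M) ^ 2 = y at hy0 hye ⊢
  generalize τ ^ 2 = t at *
  obtain ⟨κ, hκ⟩ : ∃ κ, κ = k / n := ⟨_, rfl⟩
  have hκ0 : 0 < κ := by rw [hκ]; positivity
  have hκ1 : κ ≤ 1 := by rw [hκ, div_le_one hn]; exact hkn
  have hκn : k = κ * n := by rw [hκ]; field_simp
  have hκC : κ ≤ 1 / (8 * C) := by
    refine le_of_pow_le_pow_left₀ two_ne_zero (by positivity) ?_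
    rw [hκ, div_pow, div_pow, div_le_div_iff₀ (by positivity) (by positivity)]
    calc k ^ 2 * (8 * C) ^ 2 ≤ (1024 * C * n) * (8 * C) ^ 2 := by gcongr
      _ = (65536 * C ^ 3) * n := by ring
      _ ≤ n * n := by gcongr
      _ = 1 ^ 2 * n ^ 2 := by ring
  have hyC : y ≤ 1024 * C * t := by
    refine le_of_mul_le_mul_right (a := n ^ 2) ?_ (by positivity)
    calc y * n ^ 2 ≤ y * (k * M) ^ 2 := by gcongr
      _ = k ^ 2 * (y * M ^ 2) := by ring
      _ = k ^ 2 * (n * t) := by rw [hye]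
      _ ≤ (1024 * C * n) * (n * t) := by gcongr
      _ = _ := by ring
  have hy4 : 4 * y ≤ 1 := by linarith
  have ha := exp_sub_one_sub_id_le_sq ht0.le hτ1
  have ha0 : 0 ≤ Real.exp t - 1 := by linarith [Real.add_one_le_exp t]
  obtain ⟨z, hz⟩ : ∃ z, z = k * (Real.exp t - 1) / M := ⟨_, rfl⟩
  rw [← hz]
  have hz0 : 0 ≤ z := by rw [hz]; positivity
  have htt : t * t ≤ t := mul_le_of_le_one_right ht0.le hτ1
  have hκt : κ * t ≤ t := mul_le_of_le_one_left ht0.le hκ1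
  have hzy : z ≤ y * (1 + κ + 2 * t) := by
    refine le_of_mul_le_mul_right (a := M ^ 2) ?_ (by positivity)
    have h1 : k * M ≤ n * (1 + κ) := by rw [hκn] at hkM1 ⊢; linarith
    calc z * M ^ 2 = (k * M) * (Real.exp t - 1) := by rw [hz]; field_simp
      _ ≤ (n * (1 + κ)) * (t * (1 + t)) := by
        gcongr
        linarith
      _ = n * t * ((1 + κ) * (1 + t)) := by ring
      _ ≤ n * t * (1 + κ + 2 * t) := by
        gcongr
        linarith
      _ = y * M ^ 2 * (1 + κ + 2 * t) := by rw [hye]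
      _ = y * (1 + κ + 2 * t) * M ^ 2 := by ring
  have hz4 : z ≤ 4 * y := by
    refine hzy.trans ?_
    rw [mul_comm]
    gcongr
    linarith
  have hz2 := exp_sub_one_sub_id_le_sq hz0 (hz4.trans hy4)
  have hy2 := exp_sub_one_sub_id_le_sq hy0.le (by linarith)
  have hzz : z ^ 2 ≤ (4 * y) ^ 2 := by gcongr
  have h1 : y * y ≤ y * (1024 * C * t) := by gcongr
  have h2 : κ + t * (2 + 17408 * C) ≤ 1 / (4 * C) := by
    have : 1 / (4 * C) = 1 / (8 * C) + 1 / (8 * C) := by field_simp; norm_num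
    rw [this]; linarith
  have h3 : y * (κ + t * (2 + 17408 * C)) ≤ y * (1 / (4 * C)) := by gcongr
  linarith

/-! ### Lower bounds on the sensitivity and choice of constants -/

namespace SensitivityBound

variable {k : ℕ} {C r : ℝ}
  {f : (Fin n → EuclideanSpace ℝ (Fin d)) → EuclideanSpace ℝ (Fin d)}

theorem sqrt_dim_mul_le (h : SensitivityBound k C r f) (hC : 0 ≤ C) (hr : 0 ≤ r) (hn : 0 < n)
    (hd : 0 < d) (hk : 0 < k) (hkn : k ≤ n) : √(d * k) ≤ 6 * n * r := by
  obtain ⟨blk, pos, hinj⟩ := exists_block_decomposition (n := n) hk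
  have h1 := h.sqrt_dim_le hC hr hn hd hkn blk fun l => by
    refine (Finset.card_le_card_of_injOn pos (t := Finset.univ) (fun i _ => by simp)
      fun i hi i' hi' hpp => ?_).trans (by simp)
    simp only [Finset.coe_filter, Finset.mem_univ, true_and, Set.mem_ofPred_eq] at hi hi'
    exact hinj (Prod.ext (hi.trans hi'.symm) hpp)
  have hkM : (k : ℝ) * ((n / k + 1 : ℕ) : ℝ) ≤ 2 * n := by
    have : k * (n / k + 1) ≤ 2 * n := by
      have := Nat.mul_div_le n k
      rw [mul_add]; omega
    exact_mod_cast this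
  have hkk : √(k : ℝ) * √k = k := Real.mul_self_sqrt (by positivity)
  have h2 : √(2 : ℝ) ≤ 3 / 2 := by
    rw [Real.sqrt_le_left (by norm_num)]; norm_num
  calc √(d * k) = √d * √k := Real.sqrt_mul (by positivity) _
    _ ≤ 2 * ((n / k + 1 : ℕ) : ℝ) * √(2 * k) * r * √k := by gcongr
    _ = 2 * (√2 * (√k * √k) * ((n / k + 1 : ℕ) : ℝ)) * r := by
      rw [Real.sqrt_mul (by positivity)]; ring
    _ = 2 * (√2 * (k * ((n / k + 1 : ℕ) : ℝ))) * r := by rw [hkk]; ring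
    _ ≤ 2 * (3 / 2 * (2 * n)) * r := by gcongr
    _ = 6 * n * r := by ring

theorem le_of_many_changes (h : SensitivityBound k C r f) (hC : 0 ≤ C) (hr : 0 ≤ r) (hn : 0 < n)
    (hd : 0 < d) (hk : 0 < k) (hkn : k ≤ n) (hlarge : 32 * √(C * n) ≤ k) :
    1 / 16 * (k / n) ≤ r := by
  have hn' : (0 : ℝ) < n := by exact_mod_cast hn
  have hk' : (0 : ℝ) < k := by exact_mod_cast hk
  have hkn' : (k : ℝ) ≤ n := by exact_mod_cast hkn
  -- The expected number of disagreements is then at most `2 n δ = k / 4`.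
  set δ : ℝ := k / (8 * n) with hδ
  have hδ0 : 0 < δ := by positivity
  have hδ1 : δ ≤ 1 := by
    rw [hδ, div_le_one (by positivity)]; linarith
  have hsq : √(Real.exp (δ ^ 2) - 1) ≤ 2 * δ := by
    rw [Real.sqrt_le_left (by positivity)]
    have := exp_sub_one_le_two_mul (sq_nonneg δ) (pow_le_one₀ hδ0.le hδ1)
    nlinarith
  have hkp : n * √(Real.exp (δ ^ 2) - 1) / (k + 1 : ℕ) ≤ 1 / 4 := by
    rw [div_le_iff₀ (by positivity)]
    calc n * √(Real.exp (δ ^ 2) - 1) ≤ n * (2 * δ) := by gcongr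
      _ = k / 4 := by rw [hδ]; field_simp; ring
      _ ≤ 1 / 4 * ((k + 1 : ℕ) : ℝ) := by push_cast; linarith
  have key := h.translation_le_of_coupling hC hr hd hδ0.le hkp
  have hs : √(1 / 4 : ℝ) = 1 / 2 := by
    rw [show (1 / 4 : ℝ) = (1 / 2) ^ 2 by norm_num, Real.sqrt_sq (by norm_num)]
  have hCn : √(C / n) ≤ δ / 4 := by
    have : √(C / n) = √(C * n) / n := by
      rw [show C / n = C * n / (n : ℝ) ^ 2 by field_simp, Real.sqrt_div' _ (by positivity),
        Real.sqrt_sq hn'.le]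
    rw [this, hδ, div_le_iff₀ hn']
    field_simp
    linarith
  have e : 1 / 16 * ((k : ℝ) / n) = δ / 2 := by rw [hδ]; field_simp; norm_num
  rw [e]
  rw [hs] at key
  linarith

theorem le_of_few_changes (h : SensitivityBound k C r f) (hC : 0 < C) (hr : 0 ≤ r) (hn : 0 < n)
    (hd : 0 < d) (hk : 0 < k) (hkn : k ≤ n) (hsmall : (k : ℝ) ^ 2 ≤ 1024 * C * n)
    (hnC : 65536 * C ^ 3 ≤ n) {τ : ℝ} (hτ0 : 0 < τ) (hτ1 : τ ^ 2 ≤ 1)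
    (hτ2 : 4096 * C * τ ^ 2 ≤ 1) (hτ3 : τ ^ 2 * (2 + 17408 * C) ≤ 1 / (8 * C)) :
    τ / 4 * (k / n) ≤ r := by
  have hn' : (0 : ℝ) < n := by exact_mod_cast hn
  have hk' : (0 : ℝ) < k := by exact_mod_cast hk
  have hkn' : (k : ℝ) ≤ n := by exact_mod_cast hkn
  obtain ⟨blk, pos, hinj⟩ := exists_block_decomposition (n := n) hk
  have hkM1 : (k : ℝ) * ((n / k + 1 : ℕ) : ℝ) ≤ n + k := by
    have : k * (n / k + 1) ≤ n + k := by
      have := Nat.mul_div_le n k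
      rw [mul_add]; omega
    exact_mod_cast this
  have hkM2 : (n : ℝ) ≤ k * ((n / k + 1 : ℕ) : ℝ) := by
    exact_mod_cast (Nat.lt_mul_div_succ n hk).le
  have hM0 : (0 : ℝ) < ((n / k + 1 : ℕ) : ℝ) := by positivity
  have herr := sparse_translation_error_le hC hn' hk' hM0 hkn' hkM1 hkM2 hsmall hnC hτ0 hτ1 hτ2 hτ3
  have key := fun ρ hρ => h.translation_le_of_sparse (ρ := ρ) (τ := τ) hC.le hr hd
    (Nat.succ_pos (n / k)) blk pos hinj hρ
  simp only [Nat.succ_eq_add_one] at key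
  generalize ((n / k + 1 : ℕ) : ℝ) = M at hkM1 hM0 herr key
  have hsC : 0 < √C := Real.sqrt_pos.2 hC
  have hsn : 0 < √(n : ℝ) := Real.sqrt_pos.2 hn'
  -- This `ρ` satisfies `ρ² = n (τ/M)² / (4 C)`, so the approximation loses exactly half of the
  -- shift `τ / M`.
  have hmain := key (√(n * (τ / M) ^ 2) * (1 / (2 * √C))) (by positivity) (by
    rw [mul_pow, Real.sq_sqrt (by positivity), div_pow 1, mul_pow, Real.sq_sqrt hC.le]
    refine herr.trans (le_of_eq ?_)
    norm_num)
  have hCρ : √(C / n) * (√(n * (τ / M) ^ 2) * (1 / (2 * √C))) = τ / M / 2 := by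
    rw [Real.sqrt_div' _ hn'.le, Real.sqrt_mul hn'.le, Real.sqrt_sq (by positivity)]
    field_simp
  rw [hCρ] at hmain
  have hfin : τ / 4 * (k / n) ≤ τ / M / 2 := by
    have : (k : ℝ) / n ≤ 2 / M := by
      rw [div_le_div_iff₀ hn' hM0]; linarith
    calc τ / 4 * (k / n) ≤ τ / 4 * (2 / M) := by gcongr
      _ = τ / M / 2 := by ring
  linarith

end SensitivityBound

theorem exists_const_mul_fraction_le {C : ℝ} (hC : 0 < C) :
    ∃ c : ℝ, 0 < c ∧ ∃ N : ℕ, ∀ n : ℕ, N ≤ n → ∀ d k : ℕ, 0 < d → 0 < k → k ≤ n →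
      ∀ (f : (Fin n → EuclideanSpace ℝ (Fin d)) → EuclideanSpace ℝ (Fin d)) (r : ℝ), 0 ≤ r →
        SensitivityBound k C r f → c * (k / n) ≤ r := by
  -- One value of `τ²` meeting the three smallness conditions of `le_of_few_changes` at once.
  set t : ℝ := 1 / (8 * C * (2 + 17408 * C) + 4096 * C + 1) with ht
  have ht0 : 0 < t := by positivity
  have hte : t * (8 * C * (2 + 17408 * C) + 4096 * C + 1) = 1 := by
    rw [ht]; field_simp
  have hp1 : 0 ≤ t * (8 * C * (2 + 17408 * C)) := by positivity
  have hp2 : 0 ≤ t * (4096 * C) := by positivity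
  have hs : √t ^ 2 = t := Real.sq_sqrt ht0.le
  have hs0 : 0 < √t := Real.sqrt_pos.2 ht0
  refine ⟨min (1 / 16) (√t / 4), by positivity, ⌈65536 * C ^ 3⌉₊,
    fun n hN d k hd hk hkn f r hr h => ?_⟩
  have hn : 0 < n := hk.trans_le hkn
  have hkn0 : (0 : ℝ) ≤ k / n := by positivity
  -- The coupling needs `δ` to dominate the error scale `√(C / n)`; the mixture needs `n (τ/M)²`, of
  -- order `k² τ² / n`, to stay small.
  rcases le_total (32 * √(C * n)) k with hlarge | hsmall
  · refine le_trans ?_ (h.le_of_many_changes hC.le hr hn hd hk hkn hlarge)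
    gcongr
    exact min_le_left _ _
  · refine le_trans ?_ (h.le_of_few_changes (τ := √t) hC hr hn hd hk hkn ?_
      ((Nat.le_ceil _).trans (by exact_mod_cast hN)) hs0 ?_ ?_ ?_)
    · gcongr
      exact min_le_right _ _
    · calc (k : ℝ) ^ 2 ≤ (32 * √(C * n)) ^ 2 := by gcongr
        _ = 1024 * C * n := by rw [mul_pow, Real.sq_sqrt (by positivity)]; ring
    · rw [hs]; nlinarith
    · rw [hs]; nlinarith
    · rw [hs, le_div_iff₀ (by positivity)]; nlinarith

/-! ### Reduction to standard Gaussian noise -/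

/-- The translation is given as a measurable equivalence, so that `lintegral_map_equiv` applies to
the sensitivity without its measurability. -/
theorem iidLaw_gaussianClass (μ : EuclideanSpace ℝ (Fin d)) :
    iidLaw (gaussianClass d μ) n =
      (stdLaw n d).map (MeasurableEquiv.addRight fun _ : Fin n => μ) := by
  have h1 : gaussianClass d μ = (stdGaussian _).map fun x => x + μ := by
    simp [gaussianClass, multivariateGaussian, add_comm]
  have hp : IsProbabilityMeasure ((stdGaussian (EuclideanSpace ℝ (Fin d))).map fun x => x + μ) :=
    Measure.isProbabilityMeasure_map (by fun_prop)
  have h2 := Measure.pi_map_pi (μ := fun _ : Fin n => stdGaussian (EuclideanSpace ℝ (Fin d)))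
    (f := fun _ x => x + μ) (fun _ => by fun_prop)
  rw [iidLaw, h1]
  exact h2.symm

theorem SensitivityBound.of_distributionalSensitivity_le {C r η : ℝ}
    {f : (Fin n → EuclideanSpace ℝ (Fin d)) → EuclideanSpace ℝ (Fin d)} (hf : Measurable f)
    (hacc : UniformlyMSEAccurate (gaussianClass d) C ((d : ℝ) / n) f) (hr : 0 ≤ r)
    (hsens : ∀ μ, distributionalSensitivity η 2 f (gaussianClass d μ) ≤ ENNReal.ofReal r) :
    SensitivityBound ⌊η * n⌋₊ C r f := by
  refine ⟨hf, fun μ => ?_, fun μ => ?_⟩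
  · have h1 := (le_iSup
      (fun θ => ∫⁻ x, ‖f x - θ‖ₑ ^ 2 ∂(iidLaw (gaussianClass d θ) n)) μ).trans hacc
    rw [iidLaw_gaussianClass, lintegral_map_equiv] at h1
    exact h1
  · refine ⟨fun x => pointwiseSensitivity η f (fun i => x i + μ), fun x x' hx => ?_, ?_⟩
    · have e : centered f μ x - centered f μ x' =
          f (fun i => x i + μ) - f (fun i => x' i + μ) := by
        simp [centered]
      rw [e]
      refine le_iSup₂_of_le (fun i => x' i + μ) ?_ le_rfl
      simpa [hammingDist] using hx
    · have h1 := hsens μ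
      rw [distributionalSensitivity, iidLaw_gaussianClass, lintegral_map_equiv] at h1
      have h2 := pow_le_pow_left' h1 2
      rw [← ENNReal.rpow_natCast, ← ENNReal.rpow_mul, ← ENNReal.ofReal_pow hr] at h2
      simp only [Nat.cast_ofNat, one_div, isUnit_iff_ne_zero, ne_eq, OfNat.ofNat_ne_zero,
        not_false_eq_true, IsUnit.inv_mul_cancel, ENNReal.rpow_one] at h2
      exact h2

end EmpiricalSensitivity

/-! ### Combination of the two lower bounds -/

theorem theorem3p1 (C : ℝ) (hC : 0 < C) :
    ∃ c : ℝ, 0 < c ∧ ∃ N : ℕ, ∀ n : ℕ, N ≤ n → ∀ d : ℕ, 1 ≤ d →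
      ∀ f : (Fin n → EuclideanSpace ℝ (Fin d)) → EuclideanSpace ℝ (Fin d),
        Measurable f →
        EmpiricalSensitivity.UniformlyMSEAccurate
          (EmpiricalSensitivity.gaussianClass d) C ((d : ℝ) / n) f →
        ∀ η : ℝ, 0 < η → η < 1 → 1 ≤ η * n →
          ENNReal.ofReal (c * (η + √(η * d / n))) ≤
            ⨆ μ : EuclideanSpace ℝ (Fin d),
              EmpiricalSensitivity.distributionalSensitivity η 2 f
                (EmpiricalSensitivity.gaussianClass d μ) := by
  obtain ⟨c, hc, N, hN⟩ := EmpiricalSensitivity.exists_const_mul_fraction_le hC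
  -- Since `η ≤ 2 k / n` and `√(η d / n) ≤ 12 R`, each of the two terms is charged half of `R`.
  refine ⟨min (c / 4) (1 / 24), by positivity, N, fun n hn d hd f hf hacc η hη0 hη1 hηn => ?_⟩
  set R := ⨆ μ : EuclideanSpace ℝ (Fin d), EmpiricalSensitivity.distributionalSensitivity η 2 f
    (EmpiricalSensitivity.gaussianClass d μ) with hR
  rcases eq_or_ne R ∞ with htop | htop
  · rw [htop]; exact le_top
  have hr : 0 ≤ R.toReal := ENNReal.toReal_nonneg
  have hS := EmpiricalSensitivity.SensitivityBound.of_distributionalSensitivity_le hf hacc hr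
    (η := η) fun μ => by
      rw [ENNReal.ofReal_toReal htop]
      exact le_iSup (fun μ => EmpiricalSensitivity.distributionalSensitivity η 2 f
        (EmpiricalSensitivity.gaussianClass d μ)) μ
  set k := ⌊η * n⌋₊ with hk
  have hk1 : 0 < k := Nat.floor_pos.2 hηn
  have hk1' : (1 : ℝ) ≤ k := by exact_mod_cast hk1
  have hkη : (k : ℝ) ≤ η * n := Nat.floor_le (by positivity)
  -- Rounding down costs at most a factor `2`, because `k ≥ 1`.
  have hηk : η * n ≤ 2 * k := by
    have := Nat.lt_floor_add_one (η * n)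
    rw [← hk] at this
    linarith
  have hn0 : (0 : ℝ) < n := by
    by_contra! h
    nlinarith
  have hkn : k ≤ n := by
    have : (k : ℝ) ≤ n := hkη.trans (by nlinarith)
    exact_mod_cast this
  have hn0' : 0 < n := by exact_mod_cast hn0
  have h1 := hN n hn d k hd hk1 hkn f _ hr hS
  have h2 := hS.sqrt_dim_mul_le hC.le hr hn0' hd hk1 hkn
  refine ENNReal.ofReal_le_of_le_toReal ?_
  have h3 : η ≤ 2 * (k / n) := by
    rw [← mul_div_assoc, le_div_iff₀ hn0]; exact hηk
  have h4 : √(η * d / n) ≤ 12 * R.toReal := by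
    calc √(η * d / n) ≤ √((2 / n) ^ 2 * (d * k)) := by
          refine Real.sqrt_le_sqrt ?_
          rw [div_pow, div_mul_eq_mul_div, div_le_div_iff₀ hn0 (by positivity)]
          have : (0 : ℝ) ≤ d * k * n := by positivity
          have h5 : (η * n) * (d * n) ≤ (2 * k) * (d * n) := by gcongr
          nlinarith
      _ = 2 / n * √(d * k) := by
          rw [Real.sqrt_mul (by positivity), Real.sqrt_sq (by positivity)]
      _ ≤ 2 / n * (6 * n * R.toReal) := by gcongr
      _ = 12 * R.toReal := by field_simp; ring
  calc min (c / 4) (1 / 24) * (η + √(η * d / n))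
      = min (c / 4) (1 / 24) * η + min (c / 4) (1 / 24) * √(η * d / n) := by ring
    _ ≤ c / 4 * (2 * (k / n)) + 1 / 24 * (12 * R.toReal) := by
        gcongr
        · exact min_le_left _ _
        · exact min_le_right _ _
    _ ≤ R.toReal := by linarith
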